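/- Let $p$ be a prime. Let $(R,\mathfrak m,k)$ be a noetherian local ring of characteristic $p$ that is $F$-finite (its Frobenius is finite), let $K$ be the total ring of fractions of $R$, and let $(R,\mathfrak m,k)\subset(S,\mathfrak n,l)$ be a finite local extension with corresponding morphism $f\colon \operatorname{Spec}S\to\operatorname{Spec}R$. Put $L=K\otimes_RS$ and assume that $f$ is generically flat, i.e. $L$ is flat over $K$; $[L:K]$ denotes the rank of $L$ over $K$. *Cartier algebras and modules.* A Cartier $R$-algebra is an $\mathbb N$-graded ring $\mathcal C=\bigoplus_e\mathcal C_e$ with $\mathcal C_0=R$ and $r\kappa=\kappa r^{p^e}$ for $r\in R$, $\kappa\in\mathcal C_e$. A Cartier $\mathcal C$-module is a left $\mathcal C$-module $M$ that is finite over $R$; each $\kappa\in\mathcal C_e$ then acts by an $R$-linear map $F^e_*M\to M$. The Cartier $S$-algebra $f^*\mathcal C$ is $\bigoplus_e\mathcal C_e\otimes_RS$ with $(\kappa\otimes s)(\kappa'\otimes s')=\kappa\kappa'\otimes s^{p^d}s'$ for $\kappa'\in\mathcal C_d$. *Transposability.* Let $\omega_{S/R}=\operatorname{Hom}_R(S,R)$,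 an $S$-module through $(s\mu)(t)=\mu(st)$. Let $\sigma\colon S\to\omega_{S/R}$ be an injective $S$-linear map and put $T=\sigma(1)$. For an $R$-linear $\varphi\colon F^e_*R\to R$ define $\varphi^!\colon F^e_*\omega_{S/R}\to\omega_{S/R}$ by $\varphi^!(\mu)(s)=\varphi(\mu(s^{p^e}))$; a $T$-transpose of $\varphi$ is an $S$-linear map $\varphi^\top\colon F^e_*S\to S$ with $\sigma\circ\varphi^\top=\varphi^!\circ F^e_*\sigma$ (it is unique). If $R$ is a Cartier $\mathcal C$-module, it is called $T$-transposable if every homogeneous $\kappa\in\mathcal C$ acts on $R$ by a map that has a $T$-transpose $\kappa^\top$; then $S$ is a Cartier $f^*\mathcal C$-module through $(\kappa\otimes s)\cdot t=\kappa^\top(st)$. *$F$-signature.* For a local ring $(R,\mathfrak m,k)$ as above that is a Cartier $\mathcal C$-module let $a_e(R,\mathcal C)$ be the length of the left $R$-module $\mathcal C_e/\{\kappa\in\mathcal C_e\mid\kappa R\subset\mathfrak m\}$, let $n=\gcd\{e\mid a_e(R,\mathcal C)\ne0\}$ and $\delta=\dim R+\log_p[k^{1/p}:k]$. The $F$-signature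 is $s(R,\mathcal C)=\lim_{e\to\infty}a_{en}(R,\mathcal C)/p^{en\delta}$; it is $0$ by convention if $a_e(R,\mathcal C)=0$ for all $e>0$. *$F$-regularity.* Put $\mathcal C_+=\bigoplus_{e\ge1}\mathcal C_e$. The test module $\tau(M,\mathcal C)$ of a Cartier $\mathcal C$-module $M$ is the smallest Cartier submodule $N\subset M$ such that for every associated prime $\eta$ of $M$ some power of $(\mathcal C_\eta)_+$, where $\mathcal C_\eta=\mathcal C\otimes_RR_\eta$, maps $H^0_\eta(M_\eta)$ into $H^0_\eta(N_\eta)$; here $H^0_\eta$ denotes the submodule of elements killed by a power of $\eta$. The pair $(M,\mathcal C)$ is $F$-regular if $\tau(M,\mathcal C)=M$. **Theorem.** Let $\mathcal C$ be a Cartier $R$-algebra and let $R$ be a Cartier $\mathcal C$-module. Suppose that $\sigma\colon S\to\omega_{S/R}$ is an injective $S$-linear map that is a generic isomorphism (i.e. $K\otimes_R\sigma$ is bijective), that $T=\sigma(1)\colon S\to R$ is surjective, and that $T(\mathfrak n)\subset\mathfrak m$. If $R$ is a $T$-transposable Cartier $\mathcal C$-module, then the $F$-signatures $s(R,\mathcal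 C)$ and $s(S,f^*\mathcal C)$ exist and $$[l:k]\cdot s(S,f^*\mathcal C)=[L:K]\cdot s(R,\mathcal C).$$ Moreover, $(R,\mathcal C)$ is $F$-regular if and only if $(S,f^*\mathcal C)$ is $F$-regular. -/

import Mathlib

open scoped TensorProduct

set_option linter.unusedSectionVars false

universe u v w w'

noncomputable section

/-! ### Cartier algebras and Cartier modules

Throughout `p` is a prime number and rings have characteristic `p`; in degree `e` the letter `q`
stands for `p ^ e`. -/

/-- A Cartier `R`-algebra: an `ℕ`-graded ring `⨁ₑ 𝒞ₑ` with `𝒞₀ = R` (via `coeff`) and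
`r κ = κ r^q` for `r ∈ R`, `κ ∈ 𝒞ₑ`. The graded ring is given by its homogeneous components and the
products `𝒞ₑ × 𝒞_d → 𝒞ₙ`, `e + d = n`; the two `R`-module structures of `𝒞ₑ` are left and right
multiplication by `𝒞₀ = R`. -/
structure CartierAlgebra (p : ℕ) (R : Type u) [CommRing R] where
  deg : ℕ → Type w
  [grp : ∀ e, AddCommGroup (deg e)]
  mul : ∀ {e d n : ℕ}, e + d = n → deg e →+ deg d →+ deg n
  mul_assoc : ∀ {a b c ab bc n : ℕ} (hab : a + b = ab) (hbc : b + c = bc) (h₁ : ab + c = n)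
    (h₂ : a + bc = n) (x : deg a) (y : deg b) (z : deg c),
    mul h₁ (mul hab x y) z = mul h₂ x (mul hbc y z)
  coeff : R ≃+ deg 0
  coeff_mul : ∀ r s : R, coeff (r * s) = mul (zero_add 0) (coeff r) (coeff s)
  one_mul : ∀ {e : ℕ} (x : deg e), mul (zero_add e) (coeff 1) x = x
  mul_one : ∀ {e : ℕ} (x : deg e), mul (add_zero e) x (coeff 1) = x
  coeff_mul_comm : ∀ {e : ℕ} (r : R) (x : deg e),
    mul (zero_add e) (coeff r) x = mul (add_zero e) x (coeff (r ^ p ^ e))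

namespace CartierAlgebra

attribute [instance] CartierAlgebra.grp

variable {p : ℕ} {R : Type u} [CommRing R] (C : CartierAlgebra.{u, w} p R)

/-- The right `R`-module structure of `𝒞ₑ` (`R` is commutative, so it is written on the left):
`r • κ = κ r`. -/
instance rightModule (e : ℕ) : Module R (C.deg e) where
  smul r x := C.mul (add_zero e) x (C.coeff r)
  one_smul x := C.mul_one x
  mul_smul r s x := by
    change C.mul _ x (C.coeff (r * s)) = C.mul _ (C.mul _ x (C.coeff s)) (C.coeff r)
    rw [mul_comm, C.coeff_mul]
    exact (C.mul_assoc _ _ _ _ _ _ _).symm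
  smul_zero r := by
    change C.mul _ 0 (C.coeff r) = 0
    rw [map_zero, AddMonoidHom.zero_apply]
  smul_add r x y := by
    change C.mul _ (x + y) (C.coeff r) = C.mul _ x (C.coeff r) + C.mul _ y (C.coeff r)
    rw [map_add, AddMonoidHom.add_apply]
  add_smul r s x := by
    change C.mul _ x (C.coeff (r + s)) = C.mul _ x (C.coeff r) + C.mul _ x (C.coeff s)
    rw [map_add, map_add]
  zero_smul x := by
    change C.mul _ x (C.coeff 0) = 0
    rw [map_zero, map_zero]

theorem right_smul_def {e : ℕ} (r : R) (x : C.deg e) :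
    r • x = C.mul (add_zero e) x (C.coeff r) := rfl

/-- A copy of `𝒞ₑ`, regarded as a left `R`-module. -/
structure LDeg (e : ℕ) : Type w where
  /-- the underlying element of `𝒞ₑ` -/
  val : C.deg e

/-- `LDeg e` has the same elements as `𝒞ₑ`. -/
def lequiv (e : ℕ) : C.LDeg e ≃ C.deg e := ⟨LDeg.val, LDeg.mk, fun _ => rfl, fun _ => rfl⟩

instance (e : ℕ) : AddCommGroup (C.LDeg e) := (C.lequiv e).addCommGroup

/-- The left `R`-module structure of `𝒞ₑ`. -/
instance leftModule (e : ℕ) : Module R (C.LDeg e) where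
  smul r x := ⟨C.mul (zero_add e) (C.coeff r) x.val⟩
  one_smul x := congrArg LDeg.mk (C.one_mul x.val)
  mul_smul r s x := congrArg LDeg.mk <| by
    change C.mul _ (C.coeff (r * s)) x.val = C.mul _ (C.coeff r) (C.mul _ (C.coeff s) x.val)
    rw [C.coeff_mul, C.mul_assoc]
  smul_zero r := congrArg LDeg.mk (map_zero _)
  smul_add r x y := congrArg LDeg.mk (map_add _ x.val y.val)
  add_smul r s x := congrArg LDeg.mk <| by
    change C.mul _ (C.coeff (r + s)) x.val =
      C.mul _ (C.coeff r) x.val + C.mul _ (C.coeff s) x.val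
    rw [map_add, map_add, AddMonoidHom.add_apply]
  zero_smul x := congrArg LDeg.mk <| by
    change C.mul _ (C.coeff 0) x.val = 0
    rw [map_zero, map_zero, AddMonoidHom.zero_apply]

/-- Multiplication `𝒞_d → 𝒞ₙ` by a fixed element on the left is right `R`-linear. -/
def mulLeft {e d n : ℕ} (h : e + d = n) (x : C.deg e) : C.deg d →ₗ[R] C.deg n where
  toFun y := C.mul h x y
  map_add' y z := map_add (C.mul h x) y z
  map_smul' r y := (C.mul_assoc h (add_zero d) (add_zero n) h x y (C.coeff r)).symm

end CartierAlgebra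

/-- A Cartier `𝒞`-module structure on the `R`-module `M`, i.e. a left module structure over the
graded ring `𝒞` extending the `R`-module structure. -/
structure CartierModule {p : ℕ} {R : Type u} [CommRing R] (C : CartierAlgebra.{u, w} p R)
    (M : Type v) [AddCommGroup M] [Module R M] where
  act : ∀ e : ℕ, C.deg e →+ (M →+ M)
  act_mul : ∀ {e d n : ℕ} (h : e + d = n) (x : C.deg e) (y : C.deg d) (m : M),
    act n (C.mul h x y) m = act e x (act d y m)
  act_coeff : ∀ (r : R) (m : M), act 0 (C.coeff r) m = r • m

/-- `φ` is an `R`-linear map `Fᵉ_* M → M`. -/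
def IsCartierLinear (p : ℕ) (R : Type u) [CommRing R] {M : Type v} [AddCommGroup M] [Module R M]
    (e : ℕ) (φ : M →+ M) : Prop :=
  ∀ (r : R) (m : M), φ (r ^ p ^ e • m) = r • φ m

theorem CartierModule.act_right {p : ℕ} {R : Type u} [CommRing R] {C : CartierAlgebra.{u, w} p R}
    {M : Type v} [AddCommGroup M] [Module R M] (ρ : CartierModule C M) {e : ℕ} (x)
    (r : R) (m : M) : ρ.act e (r • x) m = ρ.act e x (r • m) := by
  rw [← ρ.act_coeff r m]
  exact ρ.act_mul (add_zero e) x (C.coeff r) m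

theorem CartierModule.isCartierLinear {p : ℕ} {R : Type u} [CommRing R]
    {C : CartierAlgebra.{u, w} p R} {M : Type v} [AddCommGroup M] [Module R M]
    (ρ : CartierModule C M) {e : ℕ} (x : C.deg e) : IsCartierLinear p R e (ρ.act e x) := by
  intro r m
  rw [← ρ.act_coeff (r ^ p ^ e) m, ← ρ.act_mul (add_zero e), ← C.coeff_mul_comm, ρ.act_mul,
    ρ.act_coeff]

/-! ### The Cartier algebra `f^* 𝒞` -/

theorem frobPow_add (p : ℕ) [hp : Fact p.Prime] (R : Type u) [CommRing R] [CharP R p] {S : Type v}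
    [CommRing S] [Algebra R S] (e : ℕ) (a b : S) : (a + b) ^ p ^ e = a ^ p ^ e + b ^ p ^ e := by
  rcases subsingleton_or_nontrivial S with h | h
  · exact Subsingleton.elim _ _
  · have h0 : (p : S) = 0 := by
      rw [← map_natCast (algebraMap R S), CharP.cast_eq_zero, map_zero]
    have : CharP S p := (CharP.charP_iff_prime_eq_zero hp.out).2 h0
    exact add_pow_char_pow a b p e

section Pullback

variable {p : ℕ} [Fact p.Prime] {R : Type u} [CommRing R] [CharP R p]
  (C : CartierAlgebra.{u, w} p R) (S : Type v) [CommRing S] [Algebra R S]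

/-- The product of `f^* 𝒞`: `(κ ⊗ s) (κ' ⊗ s') = κ κ' ⊗ s^(p^d) s'` if `κ'` has degree `d`. -/
def CartierAlgebra.pullbackMul {e d n : ℕ} (h : e + d = n) :
    (C.deg e ⊗[R] S) →+ (C.deg d ⊗[R] S) →+ (C.deg n ⊗[R] S) :=
  TensorProduct.liftAddHom
    { toFun := fun x =>
        { toFun := fun s =>
            (TensorProduct.map (C.mulLeft h x)
              (LinearMap.mulLeft R (s ^ p ^ d))).toAddMonoidHom
          map_zero' := by
            rw [zero_pow (pow_ne_zero d (Fact.out : p.Prime).ne_zero), LinearMap.mulLeft_zero_eq_zero,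
              TensorProduct.map_zero_right]
            rfl
          map_add' := fun s t => by
            have : LinearMap.mulLeft R ((s + t) ^ p ^ d) =
                LinearMap.mulLeft R (s ^ p ^ d) + LinearMap.mulLeft R (t ^ p ^ d) := by
              ext; simp [frobPow_add p R, add_mul]
            rw [this, TensorProduct.map_add_right]
            rfl }
      map_zero' := by
        ext1 s
        have : C.mulLeft h 0 = 0 := by
          ext y
          change C.mul h 0 y = 0
          rw [map_zero, AddMonoidHom.zero_apply]
        change (TensorProduct.map (C.mulLeft h 0) _).toAddMonoidHom = _
        rw [this, TensorProduct.map_zero_left]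
        rfl
      map_add' := fun x x' => by
        ext1 s
        have : C.mulLeft h (x + x') = C.mulLeft h x + C.mulLeft h x' := by
          ext y
          change C.mul h (x + x') y = C.mul h x y + C.mul h x' y
          rw [map_add, AddMonoidHom.add_apply]
        change (TensorProduct.map (C.mulLeft h (x + x')) _).toAddMonoidHom = _
        rw [this, TensorProduct.map_add_left]
        rfl }
    (by
      intro r x s
      change (TensorProduct.map (C.mulLeft h (r • x)) (LinearMap.mulLeft R (s ^ p ^ d))).toAddMonoidHom
        = (TensorProduct.map (C.mulLeft h x) (LinearMap.mulLeft R ((r • s) ^ p ^ d))).toAddMonoidHom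
      have h₁ : C.mulLeft h (r • x) = r ^ p ^ d • C.mulLeft h x := by
        ext y
        change C.mul h (C.mul _ x (C.coeff r)) y = C.mul _ (C.mul h x y) (C.coeff (r ^ p ^ d))
        rw [C.mul_assoc _ (zero_add d) _ h, C.coeff_mul_comm, C.mul_assoc h (add_zero d) _ h]
      have h₂ : LinearMap.mulLeft R ((r • s) ^ p ^ d) =
          r ^ p ^ d • LinearMap.mulLeft R (s ^ p ^ d) := by
        ext; simp [smul_pow]
      rw [h₁, h₂, TensorProduct.map_smul_left, TensorProduct.map_smul_right])

theorem CartierAlgebra.pullbackMul_tmul {e d n : ℕ} (h : e + d = n) (x : C.deg e) (s : S)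
    (y : C.deg d) (t : S) :
    C.pullbackMul S h ((x) ⊗ₜ[R] s) ((y) ⊗ₜ[R] t) =
      (C.mul h x y) ⊗ₜ[R] (s ^ p ^ d * t) := rfl

/-- The identification of `S` with the degree-zero part `𝒞₀ ⊗_R S` of `f^* 𝒞`. -/
def CartierAlgebra.pullbackCoeff : S ≃+ (C.deg 0 ⊗[R] S) :=
  ((TensorProduct.lid R S).symm.trans
    (TensorProduct.congr
      ({ C.coeff with
          map_smul' := fun r s => by
            change C.coeff (r * s) = C.mul _ (C.coeff s) (C.coeff r)
            rw [mul_comm, C.coeff_mul] } : R ≃ₗ[R] C.deg 0)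
      (LinearEquiv.refl R S))).toAddEquiv

theorem CartierAlgebra.pullbackCoeff_apply (s : S) :
    C.pullbackCoeff S s = (C.coeff 1) ⊗ₜ[R] s := rfl

/-- The Cartier `S`-algebra `f^* 𝒞 = 𝒞 ⊗_R S`. -/
def CartierAlgebra.pullback : CartierAlgebra.{v, max w v} p S where
  deg e := C.deg e ⊗[R] S
  mul h := C.pullbackMul S h
  mul_assoc {a b c ab bc n} hab hbc h₁ h₂ x y z := by
    induction x using TensorProduct.induction_on with
    | zero => simp
    | add x x' hx hx' => simp only [map_add, AddMonoidHom.add_apply, hx, hx']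
    | tmul x s =>
      induction y using TensorProduct.induction_on with
      | zero => simp
      | add y y' hy hy' => simp only [map_add, AddMonoidHom.add_apply, hy, hy']
      | tmul y t =>
        induction z using TensorProduct.induction_on with
        | zero => simp
        | add z z' hz hz' => simp only [map_add, hz, hz']
        | tmul z r =>
          rw [C.pullbackMul_tmul, C.pullbackMul_tmul, C.pullbackMul_tmul, C.pullbackMul_tmul,
            C.mul_assoc hab hbc h₁ h₂]
          congr 1
          rw [← hbc, mul_pow, pow_add, pow_mul, _root_.mul_assoc]
  coeff := C.pullbackCoeff S
  coeff_mul r s := by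
    rw [C.pullbackCoeff_apply, C.pullbackCoeff_apply, C.pullbackCoeff_apply,
      C.pullbackMul_tmul, C.one_mul, pow_zero, pow_one]
  one_mul {e} x := by
    rw [C.pullbackCoeff_apply]
    induction x using TensorProduct.induction_on with
    | zero => simp
    | add y y' hy hy' => simp only [map_add, hy, hy']
    | tmul y t => rw [C.pullbackMul_tmul, C.one_mul, one_pow, _root_.one_mul]
  mul_one {e} x := by
    rw [C.pullbackCoeff_apply]
    induction x using TensorProduct.induction_on with
    | zero => simp
    | add y y' hy hy' => simp only [map_add, AddMonoidHom.add_apply, hy, hy']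
    | tmul y t => rw [C.pullbackMul_tmul, C.mul_one, pow_zero, pow_one, _root_.mul_one]
  coeff_mul_comm {e} r x := by
    rw [C.pullbackCoeff_apply, C.pullbackCoeff_apply]
    induction x using TensorProduct.induction_on with
    | zero => simp
    | add y y' hy hy' => simp only [map_add, AddMonoidHom.add_apply, hy, hy']
    | tmul y t =>
      rw [C.pullbackMul_tmul, C.pullbackMul_tmul, C.one_mul, C.mul_one, pow_zero, pow_one, mul_comm]

variable {S} {N : Type w'} [AddCommGroup N] [Module S N]

/-- The action `(κ ⊗ s) n = a κ (s n)` of `𝒞ₑ ⊗_R S` on an `S`-module `N`. -/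
def pullbackAct {e : ℕ} (a : C.deg e →+ (N →+ N))
    (ha : ∀ (r : R) (x : C.deg e) (m : N), a (r • x) m = a x (algebraMap R S r • m)) :
    (C.deg e ⊗[R] S) →+ (N →+ N) :=
  TensorProduct.liftAddHom
    { toFun := fun x =>
        { toFun := fun s => (a x).comp (DistribSMul.toAddMonoidHom N s)
          map_zero' := by ext t; simp
          map_add' := fun s s' => by ext t; simp [add_smul] }
      map_zero' := by ext s t; simp
      map_add' := fun x x' => by ext s t; simp }
    (by
      intro r x s
      ext t
      change a (r • x) (s • t) = a x ((r • s) • t)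
      rw [ha, Algebra.smul_def, mul_smul])

theorem pullbackAct_tmul {e : ℕ} (a : C.deg e →+ (N →+ N))
    (ha : ∀ (r : R) (x : C.deg e) (m : N), a (r • x) m = a x (algebraMap R S r • m))
    (x : C.deg e) (s : S) (m : N) : pullbackAct C a ha (x ⊗ₜ[R] s) m = a x (s • m) := rfl

/-- A family of `S`-linear maps `a κ : Fᵉ_* N → N`, `κ ∈ 𝒞ₑ`, that is additive and multiplicative in
`κ` and compatible with `𝒞₀ = R`, makes the `S`-module `N` a Cartier `f^* 𝒞`-module through
`(κ ⊗ s) n = a κ (s n)`. -/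
def CartierModule.ofPullback (a : ∀ e : ℕ, C.deg e →+ (N →+ N))
    (ha_lin : ∀ (e : ℕ) (x : C.deg e), IsCartierLinear p S e (a e x))
    (ha_mul : ∀ {e d n : ℕ} (h : e + d = n) (x : C.deg e) (y : C.deg d) (m : N),
      a n (C.mul h x y) m = a e x (a d y m))
    (ha_coeff : ∀ (r : R) (m : N), a 0 (C.coeff r) m = algebraMap R S r • m) :
    CartierModule (C.pullback S) N where
  act e := pullbackAct C (a e) fun r x m => by rw [C.right_smul_def, ha_mul, ha_coeff]
  act_mul {e d n} h x y t := by
    have key : ∀ (x : C.deg e ⊗[R] S) (y : C.deg d ⊗[R] S),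
        pullbackAct C (a n) (fun r x m => by rw [C.right_smul_def, ha_mul, ha_coeff])
          (C.pullbackMul S h x y) t =
        pullbackAct C (a e) (fun r x m => by rw [C.right_smul_def, ha_mul, ha_coeff]) x
          (pullbackAct C (a d) (fun r x m => by rw [C.right_smul_def, ha_mul, ha_coeff]) y t) := by
      intro x y
      induction x using TensorProduct.induction_on with
      | zero => simp only [map_zero, AddMonoidHom.zero_apply]
      | add x x' hx hx' => simp only [map_add, AddMonoidHom.add_apply, hx, hx']
      | tmul x s =>
        induction y using TensorProduct.induction_on with
        | zero => simp only [map_zero, AddMonoidHom.zero_apply]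
        | add y y' hy hy' => simp only [map_add, AddMonoidHom.add_apply, hy, hy']
        | tmul y s' =>
          rw [C.pullbackMul_tmul, pullbackAct_tmul, pullbackAct_tmul, pullbackAct_tmul, ha_mul,
            mul_smul, ha_lin]
    exact key x y
  act_coeff s t := by
    change a 0 (C.coeff 1) (s • t) = s • t
    rw [ha_coeff, map_one, one_smul]

end Pullback

/-! ### The functor `f^!` -/

section Shriek

variable (R : Type u) [CommRing R] (S : Type v) [CommRing S] [Algebra R S]
  (M : Type w') [AddCommGroup M] [Module R M]

/-- `f^! M = Hom_R(S, M)`; in particular `f^! R = ω_{S/R}`. -/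
def UpperShriek : Type _ := S →ₗ[R] M

instance : AddCommGroup (UpperShriek R S M) := inferInstanceAs (AddCommGroup (S →ₗ[R] M))

instance : Module R (UpperShriek R S M) := inferInstanceAs (Module R (S →ₗ[R] M))

instance : FunLike (UpperShriek R S M) S M := inferInstanceAs (FunLike (S →ₗ[R] M) S M)

instance : LinearMapClass (UpperShriek R S M) R S M :=
  inferInstanceAs (LinearMapClass (S →ₗ[R] M) R S M)

variable {R S M}

@[ext] theorem UpperShriek.ext {μ ν : UpperShriek R S M} (h : ∀ s, μ s = ν s) : μ = ν :=
  LinearMap.ext h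

/-- The `S`-module structure of `f^! M` by premultiplication: `(s • μ)(t) = μ(s t)`. -/
instance : Module S (UpperShriek R S M) where
  smul s μ := LinearMap.comp (R₁ := R) (show S →ₗ[R] M from μ) (LinearMap.mulLeft R s)
  one_smul μ := UpperShriek.ext fun t => congrArg μ (one_mul t)
  mul_smul s s' μ := UpperShriek.ext fun t => congrArg μ (by
    change s * s' * t = s' * (s * t); ring)
  smul_zero s := rfl
  smul_add s μ ν := rfl
  add_smul s s' μ := UpperShriek.ext fun t => by
    change μ ((s + s') * t) = μ (s * t) + μ (s' * t)
    rw [add_mul, map_add]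
  zero_smul μ := UpperShriek.ext fun t => by
    change μ (0 * t) = 0
    rw [zero_mul, map_zero]

theorem UpperShriek.smul_apply (s : S) (μ : UpperShriek R S M) (t : S) : (s • μ) t = μ (s * t) :=
  rfl

instance : IsScalarTower R S (UpperShriek R S M) where
  smul_assoc r s μ := UpperShriek.ext fun t => by
    change μ ((r • s) * t) = r • μ (s * t)
    rw [smul_mul_assoc, map_smul]

/-- For an `R`-linear `φ : Fᵉ_* M → M` the map `φ^! : Fᵉ_* f^! M → f^! M`,
`φ^!(μ)(s) = φ(μ(s^q))`. -/
def shriekMap {p : ℕ} [Fact p.Prime] [CharP R p] {e : ℕ} {φ : M →+ M}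
    (hφ : IsCartierLinear p R e φ) : UpperShriek R S M →+ UpperShriek R S M where
  toFun μ :=
    { toFun := fun s => φ (μ (s ^ p ^ e))
      map_add' := fun s t => by rw [frobPow_add p R, map_add, map_add]
      map_smul' := fun r s => by
        rw [smul_pow, map_smul, hφ]; rfl }
  map_zero' := UpperShriek.ext fun s => map_zero φ
  map_add' μ ν := UpperShriek.ext fun s => map_add φ _ _

/-! ### Transposability along a section `σ : S → ω_{S/R}` -/

variable {p : ℕ} [Fact p.Prime] [CharP R p] {C : CartierAlgebra.{u, w} p R}

/-- `ψ : Fᵉ_* S → S` is a `T`-transpose of `φ : Fᵉ_* R → R`, where `T = σ(1)`: it is `S`-linear and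
`σ ∘ ψ = φ^! ∘ Fᵉ_* σ`. -/
def IsTranspose (σ : S →ₗ[S] UpperShriek R S R) {e : ℕ} {φ : R →+ R}
    (hφ : IsCartierLinear p R e φ) (ψ : S →+ S) : Prop :=
  IsCartierLinear p S e ψ ∧ ∀ s : S, σ (ψ s) = shriekMap hφ (σ s)

/-- `R` is a `T`-transposable Cartier `𝒞`-module: every homogeneous element of `𝒞` acts on `R` by a
map that has a `T`-transpose. -/
def IsTransposable (σ : S →ₗ[S] UpperShriek R S R) (ρ : CartierModule C R) : Prop :=
  ∀ (e : ℕ) (x : C.deg e), ∃ ψ : S →+ S, IsTranspose σ (ρ.isCartierLinear x) ψ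

variable {σ : S →ₗ[S] UpperShriek R S R} {ρ : CartierModule C R}

/-- The `T`-transpose of (the action of) `κ ∈ 𝒞ₑ`; it is unique if `σ` is injective. -/
def transpose (hT : IsTransposable σ ρ) {e : ℕ} (x : C.deg e) : S →+ S := (hT e x).choose

theorem transpose_linear (hT : IsTransposable σ ρ) {e : ℕ} (x : C.deg e) :
    IsCartierLinear p S e (transpose hT x) := (hT e x).choose_spec.1

theorem transpose_spec (hT : IsTransposable σ ρ) {e : ℕ} (x : C.deg e) (s t : S) :
    σ (transpose hT x s) t = ρ.act e x (σ s (t ^ p ^ e)) :=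
  congrArg (fun μ : UpperShriek R S R => μ t) ((hT e x).choose_spec.2 s)

/-- The Cartier `f^* 𝒞`-module structure of `S` given by `κ ⊗ s ↦ κ^⊤ · s`, that is,
`(κ ⊗ s) t = κ^⊤(s t)`. -/
def transposeModule (hσ : Function.Injective σ) (hT : IsTransposable σ ρ) :
    CartierModule (C.pullback S) S :=
  CartierModule.ofPullback C
    (fun e =>
      { toFun := fun x => transpose hT x
        map_zero' := by
          ext s
          apply hσ
          ext t
          rw [transpose_spec, map_zero, AddMonoidHom.zero_apply, AddMonoidHom.zero_apply, map_zero]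
          rfl
        map_add' := fun x y => by
          ext s
          apply hσ
          ext t
          rw [transpose_spec, map_add, AddMonoidHom.add_apply, AddMonoidHom.add_apply, map_add,
            ← transpose_spec hT, ← transpose_spec hT]
          rfl })
    (fun e x => transpose_linear hT x)
    (fun {e d n} h x y s => by
      apply hσ
      ext t
      change σ (transpose hT (C.mul h x y) s) t = σ (transpose hT x (transpose hT y s)) t
      rw [transpose_spec, transpose_spec, transpose_spec, ρ.act_mul, ← pow_mul, ← pow_add, h])
    (fun r s => by
      apply hσ
      ext t
      change σ (transpose hT (C.coeff r) s) t = _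
      rw [transpose_spec, ρ.act_coeff, pow_zero, pow_one, map_smul, UpperShriek.smul_apply,
        ← Algebra.smul_def, map_smul])

end Shriek

/-! ### Test modules and `F`-regularity -/

namespace CartierModule

variable {p : ℕ} {R : Type u} [CommRing R] {C : CartierAlgebra.{u, w} p R}
  {M : Type v} [AddCommGroup M] [Module R M] (ρ : CartierModule C M)

/-- The action of `κ ∈ 𝒞ₑ` on `W⁻¹ M`: `κ (m / u) = κ (u^(q-1) m) / u`. -/
def locAct (W : Submonoid R) (e : ℕ) (hq : p ^ e ≠ 0) (x : C.deg e) :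
    LocalizedModule W M →+ LocalizedModule W M where
  toFun y := y.liftOn (fun a => LocalizedModule.mk (ρ.act e x ((a.2 : R) ^ (p ^ e - 1) • a.1)) a.2)
    (by
      rintro ⟨m, u⟩ ⟨m', u'⟩ ⟨c, hc⟩
      have hs : ∀ a : R, a ^ p ^ e = a ^ (p ^ e - 1) * a := fun a => by
        rw [← pow_succ, Nat.sub_add_cancel (Nat.pos_of_ne_zero hq)]
      simp only [Submonoid.smul_def] at hc
      refine LocalizedModule.mk_eq.2 ⟨c, ?_⟩
      simp only [Submonoid.smul_def]
      rw [← ρ.isCartierLinear, ← ρ.isCartierLinear, ← ρ.isCartierLinear, ← ρ.isCartierLinear]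
      congr 1
      rw [hs, hs, hs]
      have := congrArg (fun z => ((c : R) ^ (p ^ e - 1) * (u : R) ^ (p ^ e - 1) *
        (u' : R) ^ (p ^ e - 1)) • z) hc
      simp only [smul_smul] at this ⊢
      convert this using 2 <;> ring)
  map_zero' := by
    rw [← LocalizedModule.zero_mk (1 : W), LocalizedModule.liftOn_mk]
    simp
  map_add' y z := by
    induction y using LocalizedModule.induction_on with
    | h m u =>
    induction z using LocalizedModule.induction_on with
    | h m' u' =>
    have hs : ∀ a : R, a ^ p ^ e = a ^ (p ^ e - 1) * a := fun a => by
      rw [← pow_succ, Nat.sub_add_cancel (Nat.pos_of_ne_zero hq)]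
    rw [LocalizedModule.mk_add_mk, LocalizedModule.liftOn_mk, LocalizedModule.liftOn_mk,
      LocalizedModule.liftOn_mk, LocalizedModule.mk_add_mk]
    congr 1
    simp only [Submonoid.smul_def, Submonoid.coe_mul]
    rw [← ρ.isCartierLinear, ← ρ.isCartierLinear, ← map_add, smul_add, hs, hs]
    congr 2
    · simp only [smul_smul]; congr 1; ring
    · simp only [smul_smul]; congr 1; ring

theorem locAct_mk (W : Submonoid R) (e : ℕ) (hq : p ^ e ≠ 0) (x : C.deg e) (m : M) (u : W) :
    ρ.locAct W e hq x (LocalizedModule.mk m u) =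
      LocalizedModule.mk (ρ.act e x ((u : R) ^ (p ^ e - 1) • m)) u := rfl

/-- The localization `W⁻¹ M` as a Cartier module over `W⁻¹ 𝒞 = 𝒞 ⊗_R W⁻¹ R`. -/
def localization [Fact p.Prime] [CharP R p] (W : Submonoid R) :
    CartierModule (C.pullback (Localization W)) (LocalizedModule W M) :=
  have hq : ∀ e, p ^ e ≠ 0 := fun e => pow_ne_zero e (Fact.out : p.Prime).ne_zero
  have hs : ∀ (e : ℕ) (a : R), a ^ p ^ e = a ^ (p ^ e - 1) * a := fun e a => by
    rw [← pow_succ, Nat.sub_add_cancel (Nat.pos_of_ne_zero (hq e))]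
  CartierModule.ofPullback C
    (fun e =>
      { toFun := fun x => ρ.locAct W e (hq e) x
        map_zero' := by
          ext y
          induction y using LocalizedModule.induction_on with
          | h m u => rw [locAct_mk, map_zero]; simp
        map_add' := fun x x' => by
          ext y
          induction y using LocalizedModule.induction_on with
          | h m u =>
            rw [AddMonoidHom.add_apply, locAct_mk, locAct_mk, locAct_mk, map_add,
              AddMonoidHom.add_apply, LocalizedModule.mk_add_mk, ← smul_add,
              LocalizedModule.mk_cancel_common_left] })
    (fun e x => by
      intro c y
      change ρ.locAct W e (hq e) x (c ^ p ^ e • y) = c • ρ.locAct W e (hq e) x y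
      induction y using LocalizedModule.induction_on with
      | h m u =>
        induction c using Localization.induction_on with
        | H c =>
          obtain ⟨r, v⟩ := c
          rw [Localization.mk_pow, LocalizedModule.mk_smul_mk, locAct_mk, locAct_mk, LocalizedModule.mk_smul_mk]
          refine LocalizedModule.mk_eq.2 ⟨1, ?_⟩
          simp only [one_smul, Submonoid.smul_def, Submonoid.coe_mul, SubmonoidClass.coe_pow]
          have hl := fun (a : R) (b : M) => (ρ.isCartierLinear x a b).symm
          simp only [hl, smul_smul]
          congr 2
          have h2 := hs e ((v : R) ^ p ^ e)
          rw [mul_pow, mul_pow, mul_pow, h2]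
          ring)
    (fun {e d n} h x y z => by
      change ρ.locAct W n (hq n) (C.mul h x y) z =
        ρ.locAct W e (hq e) x (ρ.locAct W d (hq d) y z)
      induction z using LocalizedModule.induction_on with
      | h m u =>
        rw [locAct_mk, locAct_mk, locAct_mk, ρ.act_mul, ← ρ.isCartierLinear y, smul_smul]
        congr 4
        have : p ^ n - 1 = (p ^ e - 1) * p ^ d + (p ^ d - 1) := by
          have h1 := Nat.pos_of_ne_zero (hq e)
          have h2 := Nat.pos_of_ne_zero (hq d)
          rw [← h, pow_add, Nat.sub_mul, one_mul]
          have : p ^ d ≤ p ^ e * p ^ d := Nat.le_mul_of_pos_left _ h1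
          omega
        rw [this, pow_add, pow_mul])
    (fun r z => by
      change ρ.locAct W 0 (hq 0) (C.coeff r) z = _
      induction z using LocalizedModule.induction_on with
      | h m u =>
        rw [locAct_mk, ρ.act_coeff, pow_zero, Nat.sub_self, pow_zero, one_smul, algebraMap_smul,
          LocalizedModule.smul'_mk])

/-- `N` is a Cartier submodule of `M`. -/
def IsCartierSubmodule (N : Submodule R M) : Prop :=
  ∀ (e : ℕ) (x : C.deg e), ∀ m ∈ N, ρ.act e x m ∈ N

/-- `ρ.PlusOrbit h m m'`: the element `m'` arises from `m` by applying `h` homogeneous elements of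
positive degree, one after the other. The additive span of all such `m'` is `(𝒞₊)ʰ m`. -/
inductive PlusOrbit : ℕ → M → M → Prop
  | zero (m : M) : PlusOrbit 0 m m
  | succ {h : ℕ} {m m' : M} {e : ℕ} (he : 0 < e) (x : C.deg e) :
      PlusOrbit h m m' → PlusOrbit (h + 1) m (ρ.act e x m')

/-- `ρ.NilInto N' N`: some power of `𝒞₊` maps `N'` into `N`; if `N ⊆ N'` are Cartier submodules, this
says that the inclusion `N → N'` is a nil-isomorphism. -/
def NilInto (N' N : Set M) : Prop :=
  ∃ h : ℕ, ∀ m ∈ N', ∀ m', ρ.PlusOrbit h m m' → m' ∈ N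

end CartierModule

/-- `H⁰_η(M_η)`, the elements of `M_η` killed by a power of the maximal ideal of `R_η`. -/
def localH0 {R : Type u} [CommRing R] (M : Type v) [AddCommGroup M] [Module R M] (η : Ideal R)
    [η.IsPrime] : Set (LocalizedModule η.primeCompl M) :=
  {y | ∃ k : ℕ, ∀ c ∈ IsLocalRing.maximalIdeal (Localization η.primeCompl) ^ k, c • y = 0}

namespace CartierModule

variable {p : ℕ} [Fact p.Prime] {R : Type u} [CommRing R] [CharP R p]
  {C : CartierAlgebra.{u, w} p R} {M : Type v} [AddCommGroup M] [Module R M]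
  (ρ : CartierModule C M)

/-- `N` is a Cartier submodule of `M` for which the inclusion `H⁰_η(N_η) → H⁰_η(M_η)` is a
nil-isomorphism for all associated primes `η` of `M`. Here `N_η ⊆ M_η`, and
`H⁰_η(N_η) = N_η ∩ H⁰_η(M_η)`. -/
def IsTestSubmodule (N : Submodule R M) : Prop :=
  ρ.IsCartierSubmodule N ∧
    ∀ (η : Ideal R) [η.IsPrime], η ∈ associatedPrimes R M →
      (ρ.localization η.primeCompl).NilInto (localH0 M η)
        ((N.localized η.primeCompl : Set (LocalizedModule η.primeCompl M)) ∩ localH0 M η)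

/-- The test module `τ(M, 𝒞)`, the smallest submodule as in `IsTestSubmodule`. -/
def testModule : Submodule R M := sInf {N | ρ.IsTestSubmodule N}

/-- `(M, 𝒞)` is `F`-regular if `τ(M, 𝒞) = M`. -/
def IsFRegular : Prop := ρ.testModule = ⊤

end CartierModule

/-! ### The `F`-signature -/

namespace CartierModule

variable {p : ℕ} {R : Type u} [CommRing R] [IsLocalRing R] {C : CartierAlgebra.{u, w} p R}
  (ρ : CartierModule C R)

/-- The left `R`-submodule `𝒞ₑ^ns` of all `κ ∈ 𝒞ₑ` with `κ R ⊆ 𝔪`. -/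
def nonSurj (e : ℕ) : Submodule R (C.LDeg e) where
  carrier := {x | ∀ r : R, ρ.act e x.val r ∈ IsLocalRing.maximalIdeal R}
  zero_mem' r := by
    change ρ.act e 0 r ∈ _
    rw [map_zero]; exact zero_mem _
  add_mem' {x y} hx hy r := by
    change ρ.act e (x.val + y.val) r ∈ _
    rw [map_add]; exact add_mem (hx r) (hy r)
  smul_mem' c x hx r := by
    change ρ.act e (C.mul (zero_add e) (C.coeff c) x.val) r ∈ _
    rw [ρ.act_mul, ρ.act_coeff]
    exact Submodule.smul_mem _ _ (hx r)

/-- The `e`-th splitting number `a_e(R, 𝒞)`, the length of the left `R`-module `𝒞ₑ / 𝒞ₑ^ns`. (This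
length is finite if `R` is `F`-finite.) -/
def splittingNumber (e : ℕ) : ℕ := (Module.length R (C.LDeg e ⧸ ρ.nonSurj e)).toNat

/-- The greatest common divisor of all `e` with `a_e(R, 𝒞) ≠ 0`. It is `0` if `a_e(R, 𝒞) = 0` for all
`e > 0`: then the set below is unbounded. -/
def splittingPeriod : ℕ := sSup {d : ℕ | ∀ e : ℕ, ρ.splittingNumber e ≠ 0 → d ∣ e}

end CartierModule

/-- `δ = dim R + log_p [k^{1/p} : k]`, where `k` is the residue field of `R`. The degree is computed
as `[k : k^p]`. -/
def fSigExponent (p : ℕ) (R : Type u) [CommRing R] [IsLocalRing R] : ℝ :=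
  (((ringKrullDim R).unbotD 0).toNat : ℝ) +
    Real.logb p (Module.finrank
      (Subfield.closure (Set.range fun x : IsLocalRing.ResidueField R => x ^ p))
      (IsLocalRing.ResidueField R))

/-- `s` is the `F`-signature of `(R, 𝒞)`: with `n` the greatest common divisor of all `e` with
`a_e(R, 𝒞) ≠ 0`, the numbers `a_{en} / p^{enδ}` converge to `s`. If `a_e(R, 𝒞) = 0` for all `e > 0`,
that is, `n = 0`, then the `F`-signature is `0` by convention. -/
def CartierModule.HasFSignature {p : ℕ} {R : Type u} [CommRing R] [IsLocalRing R]
    {C : CartierAlgebra.{u, w} p R} (ρ : CartierModule C R) (s : ℝ) : Prop :=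
  if ρ.splittingPeriod = 0 then s = 0
  else Filter.Tendsto
    (fun e : ℕ => (ρ.splittingNumber (e * ρ.splittingPeriod) : ℝ) /
      ((p : ℝ) ^ (e * ρ.splittingPeriod)) ^ fSigExponent p R)
    Filter.atTop (nhds s)

end

noncomputable section

open IsLocalRing

/-! ### Lengths -/

/-! The numerical information sits in the splitting ideals I_e = {r : κ(r) ∈ 𝔪 for all κ ∈ 𝒞ₑ}. The
pairing 𝒞ₑ × Fᵉ_*R → k, (κ, r) ↦ κ(r) mod 𝔪, has kernels 𝒞ₑ^ns and Fᵉ_* I_e, so duality over k gives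
a_e = λ(R/I_e) · [k : k^p]^e (`CartierModule.length_quotient_nonSurj`). With q = p^e and d = dim R
the quotient a_e / q^δ is therefore λ(R/I_e) / q^d.

Colengths are compared along linear maps with torsion cokernel, because such a cokernel contributes
only O(q^(d-1)) (`exists_length_quotient_frobeniusPower_mul_le`). Over a domain, any κ ∈ 𝒞_f with 1
in its image yields a nondegenerate form κ(ab) on F^f_* R and hence a lower bound for λ(R/I_{e+f})
in terms of λ(R/I_e). So the normalized colengths increase up to a geometric error, unless the rank
of F^f_* R is so small that already λ(R/𝔪^[q]) / q^d tends to 0. If R is not a domain and the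
splitting period is nonzero, all I_e contain a common nonzerodivisor and the limit is 0.

Transposition is the identity T(κ^⊤(s) t) = κ(T(s t^q)). Since T is surjective and T(𝔫) ⊂ 𝔪, the
ideal 𝔫 is the largest one that T maps into 𝔪. Hence the splitting ideal of S is {s : T(sS) ⊂ I_e}
(`mem_splitIdeal_transposeModule`). Over a domain R, a maximal R-independent family (g_i) in S gives
maps Rⁿ → S and S → Rⁿ, s ↦ (T(s g_i)), both with torsion cokernel and compatible with the splitting
ideals. So the R-length of S modulo its splitting ideal is [L:K] · λ(R/I_e) up to O(q^(d-1)), and it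
equals [l:k] times the S-length.

For F-regularity, N ↦ {s : T(sS) ⊂ N} and N ↦ T(N) carry test submodules of R to those of S and
conversely. If {s : T(sS) ⊂ N} = S, then N = R because T is surjective; if T(N) = R, then N = S
because T(𝔫) ⊂ 𝔪. -/

theorem Module.length_compHom_eq_mul {A B : Type*} [CommRing A] [CommRing B] [IsLocalRing A]
    [IsLocalRing B] (φ : A →+* B) [hφ : IsLocalHom φ] (N : Type*) [AddCommGroup N] [Module B N] :
    @Module.length A N _ _ (Module.compHom N φ) = Module.length B N *
      letI := φ.toAlgebra
      haveI : IsLocalHom (algebraMap A B) := hφ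
      Module.length (ResidueField A) (ResidueField B) := by
  let _ := φ.toAlgebra
  have : IsLocalHom (algebraMap A B) := hφ
  let _ := Module.compHom N φ
  have : IsScalarTower A B N := ⟨fun a b n => mul_smul (φ a) b n⟩
  exact length_restrictScalars A B N

theorem Module.length_residueField (B : Type*) [CommRing B] [IsLocalRing B] :
    Module.length B (ResidueField B) = 1 := by
  have : IsSimpleModule B (ResidueField B) := by
    rw [isSimpleModule_iff_quot_maximal]
    exact ⟨maximalIdeal B, inferInstance, ⟨LinearEquiv.refl _ _⟩⟩
  exact Module.length_eq_one B _

/-- Restriction of scalars along a local homomorphism `A → B` multiplies lengths by the length over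
`A` of the residue field of `B`. -/
theorem Module.length_compHom {A B : Type*} [CommRing A] [CommRing B] [IsLocalRing A]
    [IsLocalRing B] (φ : A →+* B) [IsLocalHom φ] (N : Type*) [AddCommGroup N] [Module B N] :
    @Module.length A N _ _ (Module.compHom N φ) =
      Module.length B N * @Module.length A (ResidueField B) _ _ (Module.compHom _ φ) := by
  rw [Module.length_compHom_eq_mul φ N, Module.length_compHom_eq_mul φ (ResidueField B),
    Module.length_residueField, one_mul]

section

variable {R : Type*} [CommRing R] {M P : Type*} [AddCommGroup M] [Module R M]
  [AddCommGroup P] [Module R P]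

/-- A linear map `M → P` bounds the length of a quotient of `P` by that of a quotient of `M` and
that of a quotient of its cokernel. -/
theorem Module.length_quotient_le_add (u : M →ₗ[R] P) {M' : Submodule R M} {P' : Submodule R P}
    (h : M' ≤ P'.comap u) :
    Module.length R (P ⧸ P') ≤
      Module.length R (M ⧸ M') + Module.length R (P ⧸ (P' ⊔ LinearMap.range u)) := by
  have hle : P' ≤ P' ⊔ LinearMap.range u := le_sup_left
  have hex : Function.Exact (LinearMap.range (M'.mapQ P' u h)).subtype
      (Submodule.factor hle) := by
    rw [LinearMap.exact_iff, Submodule.range_subtype, Submodule.factor, Submodule.ker_mapQ,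
      Submodule.range_mapQ]
    simp [Submodule.map_sup]
  rw [Module.length_eq_add_of_exact _ _ (Submodule.subtype_injective _)
    (Submodule.factor_surjective hle) hex]
  gcongr
  exact Module.length_le_of_surjective _ (LinearMap.surjective_rangeRestrict _)

theorem Module.length_quotient_anti {N N' : Submodule R M} (h : N ≤ N') :
    Module.length R (M ⧸ N') ≤ Module.length R (M ⧸ N) :=
  Module.length_le_of_surjective _ (Submodule.factor_surjective h)

/-- Variant of `Module.length_quotient_le_add` with the error term expressed by the cokernel. -/
theorem Module.length_quotient_le_add_coker (u : M →ₗ[R] P) {M' : Submodule R M}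
    {P' : Submodule R P} (h : M' ≤ P'.comap u) (J : Ideal R) (hJ : J • (⊤ : Submodule R P) ≤ P') :
    Module.length R (P ⧸ P') ≤ Module.length R (M ⧸ M') +
      Module.length R ((P ⧸ LinearMap.range u) ⧸ (J • ⊤ : Submodule R (P ⧸ LinearMap.range u))) := by
  refine (Module.length_quotient_le_add u h).trans ?_
  gcongr
  have hle : (J • ⊤ : Submodule R (P ⧸ LinearMap.range u)) ≤
      (P' ⊔ LinearMap.range u).map (LinearMap.range u).mkQ := by
    have : (⊤ : Submodule R (P ⧸ LinearMap.range u)) =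
        (⊤ : Submodule R P).map (LinearMap.range u).mkQ := by
      rw [Submodule.map_top, Submodule.range_mkQ]
    rw [this, ← Submodule.map_smul'']
    exact Submodule.map_mono (hJ.trans le_sup_left)
  refine le_trans (le_of_eq ?_) (Module.length_quotient_anti hle)
  exact (Submodule.quotientQuotientEquivQuotient _ _ le_sup_right).symm.length_eq

/-- In the filtration of M/JM by powers of x, each step is a quotient of M/(J, x)M via
multiplication by a power of x. -/
theorem Module.length_quotient_sup_pow_le (J : Ideal R) (x : R) (n : ℕ) :
    Module.length R (M ⧸ ((J ⊔ Ideal.span {x ^ n}) • ⊤ : Submodule R M)) ≤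
      n * Module.length R (M ⧸ ((J ⊔ Ideal.span {x}) • ⊤ : Submodule R M)) := by
  induction n with
  | zero => simp
  | succ n ih =>
    let u : M →ₗ[R] M := LinearMap.lsmul R M (x ^ n)
    have h : ((J ⊔ Ideal.span {x}) • ⊤ : Submodule R M) ≤
        ((J ⊔ Ideal.span {x ^ (n + 1)}) • ⊤ : Submodule R M).comap u := by
      rw [Submodule.smul_le]
      intro r hr m _
      obtain ⟨j, hj, y, hy, rfl⟩ := Submodule.mem_sup.1 hr
      obtain ⟨a, rfl⟩ := Ideal.mem_span_singleton'.1 hy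
      rw [Submodule.mem_comap, LinearMap.lsmul_apply, smul_smul]
      refine Submodule.smul_mem_smul ?_ trivial
      rw [mul_add]
      refine add_mem (Ideal.mul_mem_left _ _ (Ideal.mem_sup_left hj)) (Ideal.mem_sup_right ?_)
      exact Ideal.mem_span_singleton'.2 ⟨a, by ring⟩
    have h2 : ((J ⊔ Ideal.span {x ^ n}) • ⊤ : Submodule R M) ≤
        ((J ⊔ Ideal.span {x ^ (n + 1)}) • ⊤ : Submodule R M) ⊔ LinearMap.range u := by
      rw [Submodule.sup_smul]
      refine sup_le (le_sup_of_le_left (Submodule.smul_mono_left le_sup_left)) ?_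
      refine le_sup_of_le_right ?_
      rw [Submodule.smul_le]
      intro r hr m _
      obtain ⟨a, rfl⟩ := Ideal.mem_span_singleton'.1 hr
      exact ⟨a • m, by simp [u, smul_smul]⟩
    calc _ ≤ _ := Module.length_quotient_le_add u h
      _ ≤ _ := add_le_add_right ((Module.length_quotient_anti h2).trans ih) _
      _ = _ := by push_cast; ring

/-- One generator at a time is replaced by its power; the ideal J absorbs the others, so it has to
vary in the induction. -/
theorem Module.length_quotient_sup_span_pow_le (s : Finset R) (n : ℕ) (J : Ideal R) :
    Module.length R (M ⧸ ((J ⊔ Ideal.span ((fun x => x ^ n) '' s)) • ⊤ : Submodule R M)) ≤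
      n ^ s.card * Module.length R (M ⧸ ((J ⊔ Ideal.span s) • ⊤ : Submodule R M)) := by
  classical
  induction s using Finset.induction_on generalizing J with
  | empty =>
    rw [show (fun x : R => x ^ n) '' (∅ : Finset R) = (∅ : Finset R) by simp, Finset.card_empty,
      pow_zero, one_mul]
  | insert a s ha ih =>
    have e1 : J ⊔ Ideal.span ((fun x => x ^ n) '' (insert a s : Finset R)) =
        (J ⊔ Ideal.span {a ^ n}) ⊔ Ideal.span ((fun x => x ^ n) '' s) := by
      rw [Finset.coe_insert, Set.image_insert_eq, Ideal.span_insert, sup_assoc]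
    have e2 : J ⊔ Ideal.span (insert a s : Finset R) = (J ⊔ Ideal.span s) ⊔ Ideal.span {a} := by
      rw [Finset.coe_insert, Ideal.span_insert, sup_assoc, sup_comm (Ideal.span {a})]
    have e3 : (J ⊔ Ideal.span {a ^ n}) ⊔ Ideal.span s =
        (J ⊔ Ideal.span s) ⊔ Ideal.span {a ^ n} := sup_right_comm _ _ _
    rw [e1, e2, Finset.card_insert_of_notMem ha, pow_succ, mul_assoc]
    refine (ih _).trans ?_
    gcongr
    rw [e3]
    exact Module.length_quotient_sup_pow_le _ _ _

theorem Module.length_quotient_smul_top_ne_top [Module.Finite R M] (I : Ideal R)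
    [IsArtinianRing (R ⧸ I)] : Module.length R (M ⧸ (I • ⊤ : Submodule R M)) ≠ ⊤ := by
  have : Module.Finite (R ⧸ I) (M ⧸ (I • ⊤ : Submodule R M)) :=
    Module.Finite.of_restrictScalars_finite R _ _
  have h : Function.Surjective (algebraMap R (R ⧸ I)) := Ideal.Quotient.mk_surjective
  rw [Module.length_eq_of_surjective h]
  exact Module.length_ne_top

end
end

noncomputable section

open IsLocalRing

/-! ### Growth of lengths along Frobenius powers -/

/-- The Krull dimension as a natural number. -/
def krullDimNat (R : Type*) [CommRing R] : ℕ := ((ringKrullDim R).unbotD 0).toNat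

section

variable (R : Type*) [CommRing R] [IsLocalRing R] (p : ℕ) [Fact p.Prime] [CharP R p]

/-- The Frobenius power `𝔪^[q]`, `q = p ^ e`, of the maximal ideal. -/
def frobeniusPower (e : ℕ) : Ideal R := (maximalIdeal R).map (iterateFrobenius R p e)

variable {R}

theorem pow_mem_frobeniusPower (e : ℕ) {x : R} (hx : x ∈ maximalIdeal R) :
    x ^ p ^ e ∈ frobeniusPower R p e := by
  rw [← iterateFrobenius_def p e x]
  exact Ideal.mem_map_of_mem _ hx

theorem frobeniusPower_le {e : ℕ} {I : Ideal R} (h : ∀ x ∈ maximalIdeal R, x ^ p ^ e ∈ I) :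
    frobeniusPower R p e ≤ I := by
  rw [frobeniusPower, Ideal.map_le_iff_le_comap]
  intro x hx
  rw [Ideal.mem_comap, iterateFrobenius_def]
  exact h x hx

end

section

variable {R : Type*} [CommRing R] [IsLocalRing R] [IsNoetherianRing R]

theorem height_maximalIdeal_eq_krullDimNat : (maximalIdeal R).height = krullDimNat R := by
  have h := maximalIdeal_height_eq_ringKrullDim (R := R)
  have ht : (maximalIdeal R).height ≠ ⊤ := Ideal.height_ne_top Ideal.IsPrime.ne_top'
  rw [krullDimNat, ← h, WithBot.unbotD_coe, ENat.natCast_toNat ht]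

theorem ringKrullDim_eq_krullDimNat : ringKrullDim R = krullDimNat R := by
  rw [← maximalIdeal_height_eq_ringKrullDim, height_maximalIdeal_eq_krullDimNat]
  rfl

/-- Existence of a system of parameters. -/
theorem exists_finset_isArtinianRing_quotient :
    ∃ s : Finset R, (∀ x ∈ s, x ∈ maximalIdeal R) ∧ s.card = krullDimNat R ∧
      IsArtinianRing (R ⧸ Ideal.span (s : Set R)) := by
  obtain ⟨s, hs, hc⟩ := Ideal.exists_finset_card_eq_height_of_isNoetherianRing (maximalIdeal R)
  refine ⟨s, fun x hx => hs.1.2 (Ideal.subset_span hx), ?_,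
    quotient_artinian_of_mem_minimalPrimes_of_isLocalRing _ hs⟩
  rw [height_maximalIdeal_eq_krullDimNat] at hc
  exact_mod_cast hc

/-- Dividing by a nonzerodivisor lowers the dimension by at least one, so a system of parameters of
R/(c), lifted to R, has at most d - 1 elements. -/
theorem exists_finset_isArtinianRing_quotient_sup {c : R} (hc : c ∈ nonZeroDivisors R)
    (hcm : c ∈ maximalIdeal R) :
    ∃ s : Finset R, (∀ x ∈ s, x ∈ maximalIdeal R) ∧ s.card + 1 ≤ krullDimNat R ∧
      IsArtinianRing (R ⧸ (Ideal.span {c} ⊔ Ideal.span (s : Set R))) := by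
  classical
  have hne : Ideal.span {c} ≠ ⊤ := fun h =>
    Ideal.IsPrime.ne_top' (top_le_iff.1 (h ▸ (Ideal.span_singleton_le_iff_mem _).2 hcm))
  have : Nontrivial (R ⧸ Ideal.span {c}) := Ideal.Quotient.nontrivial_iff.2 hne
  have hsurj := Ideal.Quotient.mk_surjective (I := Ideal.span {c})
  have : IsLocalRing (R ⧸ Ideal.span {c}) := IsLocalRing.of_surjective' _ hsurj
  obtain ⟨t, htm, htc, hart⟩ := exists_finset_isArtinianRing_quotient (R := R ⧸ Ideal.span {c})
  let g := Function.surjInv hsurj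
  have hg : ∀ x, Ideal.Quotient.mk (Ideal.span {c}) (g x) = x := Function.surjInv_eq hsurj
  refine ⟨t.image g, ?_, ?_, ?_⟩
  · intro x hx
    obtain ⟨y, hy, rfl⟩ := Finset.mem_image.1 hx
    have := htm y hy
    rw [mem_maximalIdeal, mem_nonunits_iff] at this ⊢
    intro hu
    exact this (hg y ▸ hu.map (Ideal.Quotient.mk (Ideal.span {c})))
  · have h1 := ringKrullDim_quotient_succ_le_of_nonZeroDivisor hc
    rw [ringKrullDim_eq_krullDimNat, ringKrullDim_eq_krullDimNat, ← htc] at h1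
    have h2 : t.card + 1 ≤ krullDimNat R := by exact_mod_cast h1
    exact (Nat.add_le_add_right Finset.card_image_le 1).trans h2
  · have e : (Ideal.span ((t.image g : Finset R) : Set R)).map (Ideal.Quotient.mk (Ideal.span {c})) =
        Ideal.span t := by
      rw [Ideal.map_span, Finset.coe_image, Set.image_image]
      simp [hg]
    rw [← e] at hart
    let E := DoubleQuot.quotQuotEquivQuotSup (Ideal.span {c})
      (Ideal.span ((t.image g : Finset R) : Set R))
    exact E.surjective.isArtinianRing

variable (p : ℕ) [Fact p.Prime] [CharP R p]

variable (N : Type*) [AddCommGroup N] [Module R N] [Module.Finite R N]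

/-- The powers x^q, x ∈ s, lie in 𝔪^[q], and passing from s to these powers multiplies the length by
at most q^|s|. The ideal J costs nothing since it kills N. -/
theorem exists_length_quotient_frobeniusPower_le_pow {J : Ideal R} {s : Finset R}
    (hs : ∀ x ∈ s, x ∈ maximalIdeal R) [IsArtinianRing (R ⧸ (J ⊔ Ideal.span (s : Set R)))]
    (hJ : J • (⊤ : Submodule R N) = ⊥) :
    ∃ D : ℕ, ∀ e : ℕ, Module.length R (N ⧸ (frobeniusPower R p e • ⊤ : Submodule R N)) ≤
      D * (p ^ e) ^ s.card := by
  obtain ⟨D, hD⟩ := ENat.ne_top_iff_exists.1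
    (Module.length_quotient_smul_top_ne_top (M := N) (J ⊔ Ideal.span (s : Set R)))
  refine ⟨D, fun e => ?_⟩
  have h := Module.length_quotient_sup_span_pow_le (M := N) s (p ^ e) J
  rw [← hD] at h
  refine (Module.length_quotient_anti ?_).trans (h.trans (le_of_eq ?_))
  · rw [Submodule.sup_smul, hJ, bot_sup_eq]
    refine Submodule.smul_mono_left (Ideal.span_le.2 ?_)
    rintro _ ⟨x, hx, rfl⟩
    exact pow_mem_frobeniusPower p e (hs x hx)
  · push_cast; ring

theorem exists_length_quotient_frobeniusPower_le :
    ∃ D : ℕ, ∀ e : ℕ, Module.length R (N ⧸ (frobeniusPower R p e • ⊤ : Submodule R N)) ≤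
      D * (p ^ e) ^ krullDimNat R := by
  obtain ⟨s, hs, hc, hart⟩ := exists_finset_isArtinianRing_quotient (R := R)
  have : IsArtinianRing (R ⧸ ((⊥ : Ideal R) ⊔ Ideal.span (s : Set R))) := by rwa [bot_sup_eq]
  rw [← hc]
  exact exists_length_quotient_frobeniusPower_le_pow p N hs (Submodule.bot_smul _)

/-- The source of all error terms: N lives over R/(c), so its lengths are O(q^(d-1)). The factor `p
^ e` on the left avoids the exponent d - 1 in natural numbers. -/
theorem exists_length_quotient_frobeniusPower_mul_le {c : R} (hc : c ∈ nonZeroDivisors R)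
    (hcN : ∀ n : N, c • n = 0) :
    ∃ D : ℕ, ∀ e : ℕ, Module.length R (N ⧸ (frobeniusPower R p e • ⊤ : Submodule R N)) * p ^ e ≤
      D * (p ^ e) ^ krullDimNat R := by
  -- A unit c forces N = 0; otherwise c lies in 𝔪 and can be completed by parameters.
  by_cases hu : IsUnit c
  · have : Subsingleton N := subsingleton_of_forall_eq 0 fun n => (hu.smul_eq_zero).1 (hcN n)
    exact ⟨0, fun e => by simp⟩
  · obtain ⟨s, hs, hcard, hart⟩ := exists_finset_isArtinianRing_quotient_sup hc
      ((mem_maximalIdeal c).2 hu)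
    have hJ : Ideal.span {c} • (⊤ : Submodule R N) = ⊥ := by
      rw [eq_bot_iff, Submodule.smul_le]
      intro r hr n _
      obtain ⟨a, rfl⟩ := Ideal.mem_span_singleton'.1 hr
      rw [mul_smul, hcN, smul_zero]; exact zero_mem _
    obtain ⟨D, hD⟩ := exists_length_quotient_frobeniusPower_le_pow p N hs hJ
    refine ⟨D, fun e => ?_⟩
    have hpos : 1 ≤ ((p ^ e : ℕ) : ℕ∞) := by
      exact_mod_cast Nat.one_le_iff_ne_zero.2 (pow_ne_zero e (Fact.out : p.Prime).ne_zero)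
    push_cast at hpos
    calc _ ≤ (D * (p ^ e : ℕ∞) ^ s.card) * p ^ e := by gcongr; exact hD e
      _ = D * (p ^ e : ℕ∞) ^ (s.card + 1) := by rw [mul_assoc, pow_succ]
      _ ≤ _ := by gcongr

end

/-! ### Modules over domains -/

section

variable {R : Type*} [CommRing R] [IsDomain R] {M : Type*} [AddCommGroup M] [Module R M]
  [Module.Finite R M]

/-- The quotient M/N has rank 0, so it is torsion, and being finitely generated it is killed by a
single nonzero element. -/
theorem Submodule.exists_smul_mem_of_finrank_eq (N : Submodule R M)
    (h : Module.finrank R N = Module.finrank R M) : ∃ c : R, c ≠ 0 ∧ ∀ m : M, c • m ∈ N := by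
  have h0 : Module.finrank R (M ⧸ N) = 0 := by
    have := N.finrank_quotient_add_finrank
    omega
  have ht : Module.IsTorsion R (M ⧸ N) := by
    rw [← Module.finrank_eq_zero_iff_isTorsion]; exact h0
  obtain ⟨c, hc⟩ := Submodule.annihilator_top_inter_nonZeroDivisors ht
  refine ⟨c, nonZeroDivisors.ne_zero hc.2, fun m => ?_⟩
  have := (Submodule.mem_annihilator.1 hc.1) (N.mkQ m) trivial
  rwa [← map_smul, Submodule.mkQ_apply, Submodule.Quotient.mk_eq_zero] at this

variable (R M) in
theorem Module.exists_linearIndependent_smul_mem_span :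
    ∃ g : Fin (Module.finrank R M) → M, LinearIndependent R g ∧
      ∃ c : R, c ≠ 0 ∧ ∀ m : M, c • m ∈ Submodule.span R (Set.range g) := by
  obtain ⟨g, hg⟩ := exists_linearIndependent_of_le_finrank (le_refl (Module.finrank R M))
  refine ⟨g, hg, Submodule.exists_smul_mem_of_finrank_eq _ ?_⟩
  rw [finrank_span_eq_card hg, Fintype.card_fin]

/-- An injective linear map `M → Hom(M, R)` yields a linear map `M → Rⁿ`, `n` the rank of `M`, with
torsion cokernel. -/
theorem LinearMap.exists_smul_mem_range_pi (β : M →ₗ[R] M →ₗ[R] R) (hβ : Function.Injective β)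
    {g : Fin (Module.finrank R M) → M} {c : R} (hc : c ≠ 0)
    (hg : ∀ m : M, c • m ∈ Submodule.span R (Set.range g)) :
    ∃ c' : R, c' ≠ 0 ∧ ∀ y, c' • y ∈ LinearMap.range (LinearMap.pi fun i => β.flip (g i)) := by
  apply Submodule.exists_smul_mem_of_finrank_eq
  -- If β m vanishes on all `g i`, it vanishes on c M, hence on M since R is a domain. Injectivity
  -- makes the range a submodule of full rank n.
  have hinj : Function.Injective (LinearMap.pi fun i => β.flip (g i)) := by
    rw [← LinearMap.ker_eq_bot, eq_bot_iff]
    intro m hm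
    have h0 : ∀ i, β m (g i) = 0 := fun i => congrFun (LinearMap.mem_ker.1 hm) i
    have hs : Submodule.span R (Set.range g) ≤ LinearMap.ker (β m) :=
      Submodule.span_le.2 (by rintro _ ⟨i, rfl⟩; exact h0 i)
    refine (Submodule.mem_bot R).2 (hβ ?_)
    rw [map_zero]
    ext x
    have := LinearMap.mem_ker.1 (hs (hg x))
    rw [map_smul, smul_eq_mul] at this
    exact (mul_eq_zero.1 this).resolve_left hc
  rw [LinearMap.finrank_range_of_inj hinj, Module.finrank_fin_fun]

end
end

noncomputable section

open IsLocalRing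

/-! ### Frobenius push-forward -/

theorem Module.length_compHom_of_surjective {A B : Type*} [CommRing A] [CommRing B]
    {φ : A →+* B} (hφ : Function.Surjective φ) (N : Type*) [AddCommGroup N] [Module B N] :
    @Module.length A N _ _ (Module.compHom N φ) = Module.length B N := by
  let _ := φ.toAlgebra
  let _ := Module.compHom N φ
  have : IsScalarTower A B N := ⟨fun a b n => mul_smul (φ a) b n⟩
  exact Module.length_eq_of_surjective hφ

theorem Module.finite_of_compHom {A B : Type*} [CommRing A] [CommRing B]
    (φ : A →+* B) (N : Type*) [AddCommGroup N] [Module B N]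
    (h : @Module.Finite A N _ _ (Module.compHom N φ)) : Module.Finite B N := by
  let _ := φ.toAlgebra
  let _ := Module.compHom N φ
  have : IsScalarTower A B N := ⟨fun a b n => mul_smul (φ a) b n⟩
  exact Module.Finite.of_restrictScalars_finite A B N

/-- The Frobenius push-forward `Fᵉ_* M`. -/
def FrobPush (_p _e : ℕ) (M : Type*) : Type _ := M

namespace FrobPush

variable (p e : ℕ) [Fact p.Prime]

instance (M : Type*) [AddCommGroup M] : AddCommGroup (FrobPush p e M) :=
  inferInstanceAs (AddCommGroup M)

variable {R : Type*} [CommRing R] [CharP R p]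
  {M : Type*} [AddCommGroup M] [Module R M] {N : Type*} [AddCommGroup N] [Module R N]

/-- The identity map `M → Fᵉ_* M`. -/
def of : M ≃+ FrobPush p e M := AddEquiv.refl M

instance : Module R (FrobPush p e M) := Module.compHom M (iterateFrobenius R p e)

theorem smul_of (r : R) (m : M) : r • of p e m = of p e (r ^ p ^ e • m) := by
  rw [← iterateFrobenius_def p e r]
  rfl

/-- Functoriality of `Fᵉ_*`. -/
def map (f : M →ₗ[R] N) : FrobPush p e M →ₗ[R] FrobPush p e N where
  toFun x := of p e (f ((of p e).symm x))
  map_add' _ _ := map_add f _ _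
  map_smul' r x := map_smul f (iterateFrobenius R p e r) ((of p e).symm x)

/-- `Fᵉ_* N` as a submodule of `Fᵉ_* M`. -/
def submodule (N : Submodule R M) : Submodule R (FrobPush p e M) where
  carrier := {x | (of p e).symm x ∈ N}
  zero_mem' := N.zero_mem
  add_mem' hx hy := N.add_mem hx hy
  smul_mem' r _ hx := N.smul_mem (iterateFrobenius R p e r) hx

theorem of_mem_submodule {N : Submodule R M} {m : M} : of p e m ∈ submodule p e N ↔ m ∈ N :=
  Iff.rfl

/-- `Fᵉ_*` is exact. -/
def quotientEquiv (N : Submodule R M) :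
    (FrobPush p e M ⧸ submodule p e N) ≃ₗ[R] FrobPush p e (M ⧸ N) :=
  (Submodule.quotEquivOfEq _ _ (by
    ext x
    exact (Submodule.Quotient.mk_eq_zero N (x := (of p e).symm x)).symm)).trans
    ((map p e N.mkQ).quotKerEquivOfSurjective fun y => by
      obtain ⟨x, hx⟩ := N.mkQ_surjective ((of p e).symm y)
      exact ⟨of p e x, hx⟩)

/-- `F^{a+b}_* = F^b_* F^a_*`. -/
def addEquiv (a b : ℕ) : FrobPush p (a + b) M ≃ₗ[R] FrobPush p b (FrobPush p a M) where
  toFun x := of p b (of p a ((of p (a + b)).symm x))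
  invFun x := of p (a + b) ((of p a).symm ((of p b).symm x))
  left_inv _ := rfl
  right_inv _ := rfl
  map_add' _ _ := rfl
  map_smul' r x := by
    obtain ⟨x, rfl⟩ := (of p (a + b)).surjective x
    rw [smul_of]
    simp only [AddEquiv.symm_apply_apply, RingHom.id_apply]
    rw [smul_of, smul_of, ← pow_mul, ← pow_add, add_comm b a]

theorem finite_iterateFrobenius (hF : (frobenius R p).Finite) :
    (iterateFrobenius R p e).Finite := by
  induction e with
  | zero => rw [iterateFrobenius_zero]; exact RingHom.Finite.id R
  | succ e ih =>
    rw [iterateFrobenius_add, iterateFrobenius_one]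
    exact ih.comp hF

theorem module_finite (hF : (frobenius R p).Finite) : Module.Finite R (FrobPush p e R) :=
  finite_iterateFrobenius p e hF

theorem module_finite_quotient (hF : (frobenius R p).Finite) (I : Ideal R) :
    Module.Finite R (FrobPush p e (R ⧸ I)) :=
  have := module_finite p e hF
  Module.Finite.of_surjective (map p e I.mkQ) fun y => by
    obtain ⟨x, hx⟩ := I.mkQ_surjective ((of p e).symm y)
    exact ⟨of p e x, hx⟩

variable [IsLocalRing R]

instance : IsLocalHom (iterateFrobenius R p e) where
  map_nonunit a ha := by
    rw [iterateFrobenius_def] at ha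
    exact (isUnit_pow_iff (pow_ne_zero e (Fact.out : p.Prime).ne_zero)).1 ha

theorem length_eq_mul : Module.length R (FrobPush p e M) =
    Module.length R M * Module.length R (FrobPush p e (ResidueField R)) :=
  Module.length_compHom (iterateFrobenius R p e) M

variable (R) in
/-- The degree `[k : k^p]` for the residue field `k`. -/
def residueDegree : ℕ :=
  Module.finrank (Subfield.closure (Set.range fun x : ResidueField R => x ^ p)) (ResidueField R)

/-- On F_* k the ring R acts through r ↦ (r mod 𝔪)^p, whose image is the subfield k^p. Hence the
R-length is the dimension over k^p, finite because Frobenius is. -/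
theorem length_residueField_one (hF : (frobenius R p).Finite) :
    Module.length R (FrobPush p 1 (ResidueField R)) = residueDegree p R ∧
      residueDegree p R ≠ 0 := by
  let k := ResidueField R
  let kp := Subfield.closure (Set.range fun x : k => x ^ p)
  have hchar : CharP k p :=
    (CharP.charP_iff_prime_eq_zero Fact.out).2 (by
      rw [← map_natCast (residue R), CharP.cast_eq_zero, map_zero])
  have hmem : ∀ y : k, y ^ p ∈ kp := fun y => Subfield.subset_closure ⟨y, rfl⟩
  -- The p-th powers already form a subfield, so taking the closure adds nothing.
  have hle : kp ≤ (frobenius k p).fieldRange := by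
    rw [Subfield.closure_le]
    rintro _ ⟨y, rfl⟩
    exact ⟨y, rfl⟩
  let φ : R →+* kp := ((frobenius k p).comp (residue R)).codRestrict kp fun r => hmem _
  have hsurj : Function.Surjective φ := by
    rintro ⟨y, hy⟩
    obtain ⟨z, rfl⟩ := hle hy
    obtain ⟨r, rfl⟩ := residue_surjective z
    exact ⟨r, rfl⟩
  -- The identity of k, from F_* k to k with R acting through φ. The latter structure is passed by
  -- hand, as it differs from the usual R-module structure of k.
  let E : @LinearEquiv R R _ _ (RingHom.id R) (RingHom.id R) _ _ (FrobPush p 1 k) k _ _ _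
      (Module.compHom k φ) :=
    @LinearEquiv.mk _ _ _ _ _ _ _ _ _ _ _ _ _ (Module.compHom k φ)
      (@LinearMap.mk _ _ _ _ _ _ _ _ _ _ (Module.compHom k φ) (of p 1 (M := k)).symm.toAddHom
        (fun r x => by
          obtain ⟨x, rfl⟩ := (of p 1).surjective x
          rw [smul_of, pow_one]
          change r ^ p • x = residue R r ^ p * x
          rw [Algebra.smul_def, map_pow]
          rfl))
      (of p 1) (fun _ => rfl) (fun _ => rfl)
  have hfin : Module.Finite R (FrobPush p 1 k) := module_finite_quotient p 1 hF (maximalIdeal R)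
  have hfin' : Module.Finite kp k :=
    Module.finite_of_compHom φ k (@Module.Finite.equiv _ _ _ _ _ _ _ (Module.compHom k φ) hfin E)
  refine ⟨?_, (Module.finrank_pos (R := kp) (M := k)).ne'⟩
  rw [show Module.length R (FrobPush p 1 (ResidueField R)) =
      @Module.length R k _ _ (Module.compHom k φ) from
      @LinearEquiv.length_eq _ _ _ _ _ _ _ (Module.compHom k φ) E,
    Module.length_compHom_of_surjective hsurj, Module.length_eq_finrank]
  rfl

/-- Since F^{e+1}_* = F_* Fᵉ_*, each Frobenius multiplies the length by [k : k^p]. -/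
theorem length_residueField (hF : (frobenius R p).Finite) :
    Module.length R (FrobPush p e (ResidueField R)) = (residueDegree p R : ℕ∞) ^ e := by
  induction e with
  | zero =>
    rw [pow_zero, ← Module.length_residueField R]
    refine LinearEquiv.length_eq
      { (of p 0 (M := ResidueField R)).symm with
        map_smul' := fun r x => ?_ }
    obtain ⟨x, rfl⟩ := (of p 0).surjective x
    rw [smul_of, pow_zero, pow_one]
    rfl
  | succ e ih =>
    rw [(addEquiv p (R := R) (M := ResidueField R) e 1).length_eq, length_eq_mul, ih,
      (length_residueField_one p hF).1, pow_succ]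

theorem length_eq (hF : (frobenius R p).Finite) : Module.length R (FrobPush p e M) =
    Module.length R M * (residueDegree p R : ℕ∞) ^ e := by
  rw [length_eq_mul, length_residueField p e hF]

theorem length_quotient (hF : (frobenius R p).Finite) (N : Submodule R M) :
    Module.length R (FrobPush p e M ⧸ submodule p e N) =
      Module.length R (M ⧸ N) * (residueDegree p R : ℕ∞) ^ e := by
  rw [(quotientEquiv p e N).length_eq, length_eq p e hF]

end FrobPush

/-! ### Duality over the residue field -/

theorem Module.length_quotient_ker_of_surjective {R : Type*} [CommRing R] {X Y : Type*}
    [AddCommGroup X] [Module R X] [AddCommGroup Y] [Module R Y] (f : X →ₗ[R] Y)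
    (hf : Function.Surjective f) : Module.length R (X ⧸ LinearMap.ker f) = Module.length R Y :=
  (f.quotKerEquivOfSurjective hf).length_eq

section

variable {R k : Type*} [CommRing R] [Field k] [Algebra R k]
  {X : Type*} [AddCommGroup X] [Module R X]

/-- As R → k is onto, the image of Ψ is already a k-subspace and equals its span. -/
theorem Module.length_quotient_ker_eq_finrank (hk : Function.Surjective (algebraMap R k))
    {W : Type*} [AddCommGroup W] [Module k W]
    [Module R W] [IsScalarTower R k W] [FiniteDimensional k W] (Ψ : X →ₗ[R] W) :
    Module.length R (X ⧸ LinearMap.ker Ψ) =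
      Module.finrank k (Submodule.span k (Set.range Ψ)) := by
  have hmem : ∀ y ∈ Submodule.span k (Set.range Ψ), ∃ x, Ψ x = y := by
    intro y hy
    induction hy using Submodule.span_induction with
    | mem y hy => exact hy
    | zero => exact ⟨0, map_zero _⟩
    | add y z _ _ hy hz =>
      obtain ⟨a, rfl⟩ := hy
      obtain ⟨b, rfl⟩ := hz
      exact ⟨a + b, map_add _ _ _⟩
    | smul c y _ hy =>
      obtain ⟨a, rfl⟩ := hy
      obtain ⟨r, rfl⟩ := hk c
      exact ⟨r • a, by rw [map_smul, algebraMap_smul]⟩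
  let ΨD : X →ₗ[R] Submodule.span k (Set.range Ψ) :=
    { toFun := fun x => ⟨Ψ x, Submodule.subset_span ⟨x, rfl⟩⟩
      map_add' := fun x y => Subtype.ext (map_add Ψ x y)
      map_smul' := fun r x => Subtype.ext (map_smul Ψ r x) }
  have hΨD : Function.Surjective ΨD := by
    rintro ⟨y, hy⟩
    obtain ⟨x, rfl⟩ := hmem y hy
    exact ⟨x, rfl⟩
  have hker : LinearMap.ker Ψ = LinearMap.ker ΨD := by
    ext x
    simp [ΨD]
  rw [hker, Module.length_quotient_ker_of_surjective ΨD hΨD, Module.length_eq_of_surjective hk,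
    Module.length_eq_finrank]

/-- Both sides of a pairing with values in the residue field have the same length modulo the
kernels. -/
theorem Module.length_quotient_ker_flip (hk : Function.Surjective (algebraMap R k))
    {B : Type*} [AddCommGroup B] [Module R B]
    [Module.Finite R B] (ψ : X →ₗ[R] B →ₗ[R] k) :
    Module.length R (X ⧸ LinearMap.ker ψ) = Module.length R (B ⧸ LinearMap.ker ψ.flip) := by
  -- The image of X is a subspace D' of the dual of V = k ⊗ B, while the right kernel is the
  -- preimage of the common zeros D'^⊥ ⊂ V. The two lengths are dim D' and dim V/D'^⊥.
  let E : (B →ₗ[R] k) ≃ₗ[k] Module.Dual k (k ⊗[R] B) := LinearMap.liftBaseChangeEquiv k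
  have hE : ∀ f b, E f (1 ⊗ₜ b) = f b := fun f b => by
    change LinearMap.liftBaseChange k f (1 ⊗ₜ b) = f b
    rw [LinearMap.liftBaseChange_tmul, one_smul]
  have : FiniteDimensional k (B →ₗ[R] k) := Module.Finite.equiv E.symm
  let D := Submodule.span k (Set.range ψ)
  let D' : Subspace k (Module.Dual k (k ⊗[R] B)) := D.map E.toLinearMap
  have h1 : Module.length R (X ⧸ LinearMap.ker ψ) = Module.finrank k D' := by
    rw [Module.length_quotient_ker_eq_finrank hk ψ, LinearEquiv.finrank_map_eq E D]
  let q : B →ₗ[R] (k ⊗[R] B) ⧸ D'.dualCoannihilator :=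
    (D'.dualCoannihilator.mkQ.restrictScalars R).comp (TensorProduct.mk R k B 1)
  have hq : Function.Surjective q :=
    (Submodule.mkQ_surjective _).comp (TensorProduct.mk_surjective R B k hk)
  have hqker : LinearMap.ker q = LinearMap.ker ψ.flip := by
    ext b
    have : b ∈ LinearMap.ker q ↔ (1 : k) ⊗ₜ[R] b ∈ D'.dualCoannihilator :=
      Submodule.Quotient.mk_eq_zero _
    rw [this, Submodule.mem_dualCoannihilator, LinearMap.mem_ker, LinearMap.ext_iff]
    constructor
    · intro h x
      exact (hE _ _).symm.trans (h (E (ψ x)) ⟨ψ x, Submodule.subset_span ⟨x, rfl⟩, rfl⟩)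
    · rintro h _ ⟨f, hf, rfl⟩
      refine (hE _ _).trans ?_
      induction hf using Submodule.span_induction with
      | mem f hf => obtain ⟨x, rfl⟩ := hf; exact h x
      | zero => rfl
      | add f g _ _ hf hg => rw [LinearMap.add_apply, hf, hg, add_zero]
      | smul c f _ hf => rw [LinearMap.smul_apply, hf, smul_zero]
  have h2 : Module.length R (B ⧸ LinearMap.ker ψ.flip) =
      Module.finrank k ((k ⊗[R] B) ⧸ D'.dualCoannihilator) := by
    rw [← hqker, Module.length_quotient_ker_of_surjective q hq, Module.length_eq_of_surjective hk,
      Module.length_eq_finrank]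
  have h3 := Subspace.finrank_add_finrank_dualCoannihilator_eq D'
  have h4 := D'.dualCoannihilator.finrank_quotient_add_finrank
  rw [h1, h2]
  congr 1
  omega

end
end

noncomputable section

open IsLocalRing

/-! ### Splitting ideals -/

section

variable {R : Type*} [CommRing R]

theorem Module.length_quotient_pi_ideal (n : ℕ) (I : Ideal R) :
    Module.length R ((Fin n → R) ⧸ Submodule.pi Set.univ fun _ : Fin n => I) =
      n * Module.length R (R ⧸ I) := by
  rw [(Submodule.quotientPi fun _ : Fin n => I).length_eq, Module.length_pi]
  simp

theorem Ideal.smul_top_le_pi {n : ℕ} {J I : Ideal R} (h : J ≤ I) :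
    J • (⊤ : Submodule R (Fin n → R)) ≤ Submodule.pi Set.univ fun _ : Fin n => I := by
  rw [Submodule.smul_le]
  intro r hr m _ i _
  exact I.mul_mem_right _ (h hr)

end

section colength

variable {R : Type*} [CommRing R] [IsLocalRing R] [IsNoetherianRing R]

/-- The colength of an ideal. -/
def Ideal.colength (I : Ideal R) : ℕ := (Module.length R (R ⧸ I)).toNat

variable (p : ℕ) [Fact p.Prime] [CharP R p]

theorem exists_colength_frobeniusPower_le : ∃ D : ℕ, ∀ (e : ℕ) (I : Ideal R),
    frobeniusPower R p e ≤ I → Module.length R (R ⧸ I) ≤ D * (p ^ e) ^ krullDimNat R := by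
  obtain ⟨D, hD⟩ := exists_length_quotient_frobeniusPower_le (R := R) p R
  refine ⟨D, fun e I hI => (Module.length_quotient_anti ?_).trans (hD e)⟩
  rw [smul_eq_mul, Ideal.mul_top]
  exact hI

/-- An ideal containing some 𝔪^[q] has finite colength, so passing to natural numbers loses nothing.
-/
theorem Ideal.coe_colength {e : ℕ} {I : Ideal R} (hI : frobeniusPower R p e ≤ I) :
    (I.colength : ℕ∞) = Module.length R (R ⧸ I) := by
  obtain ⟨D, hD⟩ := exists_colength_frobeniusPower_le (R := R) p
  refine ENat.natCast_toNat (ne_top_of_le_ne_top ?_ (hD e I hI))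
  exact_mod_cast ENat.natCast_ne_top (D * (p ^ e) ^ krullDimNat R)

theorem Ideal.colength_ne_zero_iff {e : ℕ} {I : Ideal R} (hI : frobeniusPower R p e ≤ I) :
    I.colength ≠ 0 ↔ I ≠ ⊤ := by
  rw [← Nat.cast_ne_zero (R := ℕ∞), I.coe_colength p hI, Ne, Module.length_eq_zero_iff,
    Submodule.Quotient.subsingleton_iff]

theorem pow_mem_frobeniusPower_add {e : ℕ} (f : ℕ) {x : R} (hx : x ∈ frobeniusPower R p e) :
    x ^ p ^ f ∈ frobeniusPower R p (e + f) := by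
  rw [← iterateFrobenius_def p f x, frobeniusPower, add_comm, iterateFrobenius_add, ← Ideal.map_map]
  exact Ideal.mem_map_of_mem _ hx

end colength

namespace CartierModule

variable {p : ℕ} [Fact p.Prime] {R : Type u} [CommRing R] [IsLocalRing R] [CharP R p]
  {C : CartierAlgebra.{u, w} p R} (ρ : CartierModule C R)

/-- The ideal of all `r ∈ R` with `κ r ∈ 𝔪` for all `κ ∈ 𝒞ₑ`. -/
def splitIdeal (e : ℕ) : Ideal R where
  carrier := {r | ∀ x : C.deg e, ρ.act e x r ∈ maximalIdeal R}
  zero_mem' x := by rw [map_zero]; exact zero_mem _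
  add_mem' hr hs x := by rw [map_add]; exact add_mem (hr x) (hs x)
  smul_mem' c r hr x := by rw [← ρ.act_right]; exact hr _

theorem mem_splitIdeal {e : ℕ} {r : R} :
    r ∈ ρ.splitIdeal e ↔ ∀ x : C.deg e, ρ.act e x r ∈ maximalIdeal R := Iff.rfl

/-- For r ∈ 𝔪 one has κ(r^q) = r κ(1) ∈ 𝔪. -/
theorem frobeniusPower_le_splitIdeal (e : ℕ) : frobeniusPower R p e ≤ ρ.splitIdeal e := by
  refine frobeniusPower_le p fun r hr x => ?_
  have := ρ.isCartierLinear x r 1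
  rw [smul_eq_mul, mul_one] at this
  rw [this]
  exact Ideal.mul_mem_right _ _ hr

/-- Because 𝒞ₑ 𝒞_f ⊂ 𝒞_{e+f}. This links the splitting ideals of different degrees. -/
theorem act_mem_splitIdeal {e f : ℕ} (x : C.deg f) {r : R} (hr : r ∈ ρ.splitIdeal (e + f)) :
    ρ.act f x r ∈ ρ.splitIdeal e := fun y => by
  rw [← ρ.act_mul rfl]
  exact hr _

/-- The action of `κ ∈ 𝒞ₑ` as a linear map `Fᵉ_* R → R`. -/
def actPush {e : ℕ} (x : C.deg e) : FrobPush p e R →ₗ[R] R where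
  toFun r := ρ.act e x ((FrobPush.of p e).symm r)
  map_add' _ _ := map_add _ _ _
  map_smul' r m := by
    obtain ⟨m, rfl⟩ := (FrobPush.of p e).surjective m
    rw [FrobPush.smul_of]
    exact ρ.isCartierLinear x r m

/-- The pairing `𝒞ₑ × Fᵉ_* R → k`. -/
def pairing (e : ℕ) : C.LDeg e →ₗ[R] FrobPush p e R →ₗ[R] ResidueField R where
  toFun x := (Algebra.linearMap R (ResidueField R)).comp (ρ.actPush x.val)
  map_add' x y := by
    ext m
    change residue R (ρ.act e (x.val + y.val) _) = residue R _ + residue R _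
    rw [map_add, AddMonoidHom.add_apply, map_add]
    rfl
  map_smul' r x := by
    ext m
    change residue R (ρ.act e (C.mul (zero_add e) (C.coeff r) x.val) _) = r • residue R _
    rw [ρ.act_mul, ρ.act_coeff, smul_eq_mul, map_mul]
    rfl

/-- The left kernel of the pairing is 𝒞ₑ^ns, the right kernel Fᵉ_* I_e; a pairing into k has equal
lengths modulo its kernels, and Fᵉ_* multiplies lengths by [k : k^p]^e. -/
theorem length_quotient_nonSurj (hF : (frobenius R p).Finite) (e : ℕ) :
    Module.length R (C.LDeg e ⧸ ρ.nonSurj e) =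
      Module.length R (R ⧸ ρ.splitIdeal e) * (FrobPush.residueDegree p R : ℕ∞) ^ e := by
  have hfin := FrobPush.module_finite p e hF
  have h1 : ρ.nonSurj e = LinearMap.ker (ρ.pairing e) := by
    ext x
    rw [LinearMap.mem_ker, LinearMap.ext_iff]
    exact forall_congr' fun r => (residue_eq_zero_iff _).symm
  have h2 : FrobPush.submodule p e (ρ.splitIdeal e) = LinearMap.ker (ρ.pairing e).flip := by
    ext r
    rw [LinearMap.mem_ker, LinearMap.ext_iff]
    exact ⟨fun h x => (residue_eq_zero_iff _).2 (h x.val),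
      fun h x => (residue_eq_zero_iff _).1 (h ⟨x⟩)⟩
  rw [h1, Module.length_quotient_ker_flip residue_surjective, ← h2, FrobPush.length_quotient p e hF]

variable [IsNoetherianRing R]

theorem splittingNumber_eq (hF : (frobenius R p).Finite) (e : ℕ) :
    ρ.splittingNumber e = (ρ.splitIdeal e).colength * FrobPush.residueDegree p R ^ e := by
  rw [splittingNumber, ρ.length_quotient_nonSurj hF,
    ← Ideal.coe_colength p (ρ.frobeniusPower_le_splitIdeal e)]
  exact_mod_cast ENat.toNat_natCast _

theorem splittingNumber_ne_zero_iff (hF : (frobenius R p).Finite) (e : ℕ) :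
    ρ.splittingNumber e ≠ 0 ↔ ρ.splitIdeal e ≠ ⊤ := by
  rw [ρ.splittingNumber_eq hF, mul_ne_zero_iff,
    Ideal.colength_ne_zero_iff p (ρ.frobeniusPower_le_splitIdeal e)]
  exact and_iff_left (pow_ne_zero e (FrobPush.length_residueField_one p hF).2)

theorem exists_act_eq_one {e : ℕ} (h : ρ.splitIdeal e ≠ ⊤) :
    ∃ (x : C.deg e) (r : R), ρ.act e x r = 1 := by
  have : (1 : R) ∉ ρ.splitIdeal e := fun h1 => h ((Ideal.eq_top_iff_one _).2 h1)
  rw [mem_splitIdeal] at this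
  push Not at this
  obtain ⟨x, hx⟩ := this
  rw [mem_maximalIdeal, mem_nonunits_iff, not_not] at hx
  obtain ⟨b, hb⟩ := hx.exists_left_inv
  -- The value κ(1) is a unit with inverse b, and κ(b^q) = b κ(1) = 1.
  exact ⟨x, b ^ p ^ e • 1, by rw [ρ.isCartierLinear, smul_eq_mul, hb]⟩

/-- If κ(r) = 1 and κ'(s) = 1 with κ' of degree f, then κκ'(r^{p^f} s) = κ(r κ'(s)) = 1. -/
theorem splitIdeal_add_ne_top {e f : ℕ} (he : ρ.splitIdeal e ≠ ⊤) (hf : ρ.splitIdeal f ≠ ⊤) :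
    ρ.splitIdeal (e + f) ≠ ⊤ := by
  obtain ⟨x, r, hx⟩ := ρ.exists_act_eq_one he
  obtain ⟨y, s, hy⟩ := ρ.exists_act_eq_one hf
  intro htop
  have : r ^ p ^ f * s ∈ ρ.splitIdeal (e + f) := htop ▸ trivial
  have h1 := this (C.mul rfl x y)
  rw [ρ.act_mul, ← smul_eq_mul, ρ.isCartierLinear, hy, smul_eq_mul, mul_one, hx] at h1
  exact (Ideal.ne_top_iff_one _).1 Ideal.IsPrime.ne_top' h1

/-! ### Comparison of colengths over a domain -/

section domain

variable [IsDomain R]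

/-- The form `(a, b) ↦ κ(ab)` on `Fᵉ_* R`. -/
def actForm {f : ℕ} (x : C.deg f) : FrobPush p f R →ₗ[R] FrobPush p f R →ₗ[R] R :=
  LinearMap.mk₂ R
    (fun a b => ρ.act f x ((FrobPush.of p f).symm a * (FrobPush.of p f).symm b))
    (fun a a' b => by rw [map_add, add_mul, map_add])
    (fun r a b => by
      obtain ⟨a, rfl⟩ := (FrobPush.of p f).surjective a
      rw [FrobPush.smul_of]
      simp only [AddEquiv.symm_apply_apply]
      rw [smul_mul_assoc, ρ.isCartierLinear])
    (fun a b b' => by rw [map_add, mul_add, map_add])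
    (fun r a b => by
      obtain ⟨b, rfl⟩ := (FrobPush.of p f).surjective b
      rw [FrobPush.smul_of]
      simp only [AddEquiv.symm_apply_apply]
      rw [mul_smul_comm, ρ.isCartierLinear])

/-- Pairing a with a^{q-1} r, q = p^f, gives κ(a^q r) = a κ(r) = a. -/
theorem actForm_injective {f : ℕ} {x : C.deg f} {r : R} (hx : ρ.act f x r = 1) :
    Function.Injective (ρ.actForm x) := by
  rw [injective_iff_map_eq_zero]
  intro a ha
  obtain ⟨a, rfl⟩ := (FrobPush.of p f).surjective a
  have h : ρ.act f x (a * (a ^ (p ^ f - 1) * r)) = 0 :=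
    congrArg (fun l : FrobPush p f R →ₗ[R] R => l (FrobPush.of p f (a ^ (p ^ f - 1) * r))) ha
  have hq : p ^ f ≠ 0 := pow_ne_zero f (Fact.out : p.Prime).ne_zero
  rw [← mul_assoc, mul_pow_sub_one hq, ← smul_eq_mul, ρ.isCartierLinear, hx, smul_eq_mul,
    mul_one] at h
  rw [h, map_zero]

/-- The map F^f_* R → Rⁿ, a ↦ (κ(a g_i)), has torsion cokernel and sends the splitting ideal of
degree e + f into that of degree e in each coordinate. -/
theorem exists_rank_mul_colength_le (hF : (frobenius R p).Finite) {f : ℕ}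
    (hf : ρ.splitIdeal f ≠ ⊤) : ∃ D : ℕ, ∀ e : ℕ,
      Module.finrank R (FrobPush p f R) * (ρ.splitIdeal e).colength * p ^ e ≤
        (ρ.splitIdeal (e + f)).colength * FrobPush.residueDegree p R ^ f * p ^ e +
          D * (p ^ e) ^ krullDimNat R := by
  have hfin := FrobPush.module_finite p f hF
  obtain ⟨x, r, hx⟩ := ρ.exists_act_eq_one hf
  obtain ⟨g, -, c, hc, hg⟩ :=
    Module.exists_linearIndependent_smul_mem_span R (FrobPush p f R)
  obtain ⟨c', hc', hu⟩ := LinearMap.exists_smul_mem_range_pi (ρ.actForm x)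
    (ρ.actForm_injective hx) hc hg
  set u := LinearMap.pi fun i => (ρ.actForm x).flip (g i) with hudef
  obtain ⟨D, hD⟩ := exists_length_quotient_frobeniusPower_mul_le p
    ((Fin (Module.finrank R (FrobPush p f R)) → R) ⧸ LinearMap.range u)
    (mem_nonZeroDivisors_of_ne_zero hc') (fun n => by
      obtain ⟨y, rfl⟩ := Submodule.mkQ_surjective _ n
      rw [← map_smul, Submodule.mkQ_apply, Submodule.Quotient.mk_eq_zero]
      exact hu y)
  refine ⟨D, fun e => ?_⟩
  have h := Module.length_quotient_le_add_coker u
    (M' := FrobPush.submodule p f (ρ.splitIdeal (e + f)))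
    (P' := Submodule.pi Set.univ fun _ => ρ.splitIdeal e)
    (fun m hm i _ => ρ.act_mem_splitIdeal x (Ideal.mul_mem_right _ _ hm))
    (frobeniusPower R p e) (Ideal.smul_top_le_pi (ρ.frobeniusPower_le_splitIdeal e))
  rw [Module.length_quotient_pi_ideal, FrobPush.length_quotient p f hF,
    ← Ideal.coe_colength p (ρ.frobeniusPower_le_splitIdeal e),
    ← Ideal.coe_colength p (ρ.frobeniusPower_le_splitIdeal (e + f))] at h
  have h2 := (mul_le_mul_left h ((p : ℕ∞) ^ e)).trans
    ((add_mul _ _ _).le.trans (add_le_add_right (hD e) _))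
  exact_mod_cast h2

end domain

end CartierModule

section domain

variable (p : ℕ) [Fact p.Prime] {R : Type u} [CommRing R] [IsLocalRing R] [CharP R p]
  [IsNoetherianRing R] [IsDomain R]

/-- A maximal independent family of F^f_* R spans a free submodule with torsion cokernel, and
multiplication by r ∈ 𝔪^[p^e] is multiplication by r^{p^f} ∈ 𝔪^[p^(e+f)] on the underlying ring. -/
theorem exists_colength_frobeniusPower_add_le (hF : (frobenius R p).Finite) (f : ℕ) :
    ∃ D : ℕ, ∀ e : ℕ,
      (frobeniusPower R p (e + f)).colength * FrobPush.residueDegree p R ^ f * p ^ e ≤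
        Module.finrank R (FrobPush p f R) * (frobeniusPower R p e).colength * p ^ e +
          D * (p ^ e) ^ krullDimNat R := by
  have hfin := FrobPush.module_finite p f hF
  obtain ⟨g, -, c, hc, hg⟩ :=
    Module.exists_linearIndependent_smul_mem_span R (FrobPush p f R)
  let u := Fintype.linearCombination R g
  obtain ⟨D, hD⟩ := exists_length_quotient_frobeniusPower_mul_le p
    (FrobPush p f R ⧸ LinearMap.range u)
    (mem_nonZeroDivisors_of_ne_zero hc) (fun n => by
      obtain ⟨y, rfl⟩ := Submodule.mkQ_surjective _ n
      rw [← map_smul, Submodule.mkQ_apply, Submodule.Quotient.mk_eq_zero,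
        Fintype.range_linearCombination]
      exact hg y)
  refine ⟨D, fun e => ?_⟩
  have hsm : ∀ r ∈ frobeniusPower R p e, ∀ m : FrobPush p f R,
      r • m ∈ FrobPush.submodule p f (frobeniusPower R p (e + f)) := by
    intro r hr m
    obtain ⟨m, rfl⟩ := (FrobPush.of p f).surjective m
    rw [FrobPush.smul_of, FrobPush.of_mem_submodule]
    exact Ideal.mul_mem_right _ _ (pow_mem_frobeniusPower_add p f hr)
  have h := Module.length_quotient_le_add_coker u
    (M' := Submodule.pi Set.univ fun _ => frobeniusPower R p e)
    (P' := FrobPush.submodule p f (frobeniusPower R p (e + f)))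
    (fun m hm => by
      rw [Submodule.mem_comap, Fintype.linearCombination_apply]
      exact Submodule.sum_mem _ fun i _ => hsm _ (hm i trivial) _)
    (frobeniusPower R p e) (Submodule.smul_le.2 fun r hr m _ => hsm r hr m)
  rw [Module.length_quotient_pi_ideal, FrobPush.length_quotient p f hF,
    ← Ideal.coe_colength p (le_refl (frobeniusPower R p e)),
    ← Ideal.coe_colength p (le_refl (frobeniusPower R p (e + f)))] at h
  have h2 := (mul_le_mul_left h ((p : ℕ∞) ^ e)).trans
    ((add_mul _ _ _).le.trans (add_le_add_right (hD e) _))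
  exact_mod_cast h2

end domain
end

noncomputable section

open IsLocalRing Filter Topology

/-! ### Convergence of sequences -/

theorem tendsto_zero_of_contracting_add {q : ℝ} (hq : 2 ≤ q) {x : ℕ → ℝ} (hx : ∀ e, 0 ≤ x e) {B : ℝ}
    (hB : ∀ e, x e ≤ B) {f : ℕ} (hf : 0 < f) {θ D : ℝ} (hθ : 0 ≤ θ) (hθ' : θ < 1) (hD : 0 ≤ D)
    (h : ∀ e, x (e + f) ≤ θ * x e + D / q ^ e) : Tendsto x atTop (𝓝 0) := by
  have hq0 : (0 : ℝ) < q := by linarith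
  have hqe : ∀ e : ℕ, 0 < q ^ e := fun e => pow_pos hq0 e
  have hqf : 2 ≤ q ^ f := hq.trans (le_self_pow₀ (by linarith) hf.ne')
  -- Adding K/q^e to x absorbs the error: D/q^e is at most a quarter of K/q^e, and K/q^{e+f} at most
  -- half of it, so the corrected sequence y contracts by η = max(θ, 3/4).
  let K : ℝ := 4 * D + 1
  have hK : 0 < K := by positivity
  let η : ℝ := max θ (3 / 4)
  have hη : η < 1 := max_lt hθ' (by norm_num)
  have hη0 : 0 ≤ η := hθ.trans (le_max_left _ _)
  let y : ℕ → ℝ := fun e => x e + K / q ^ e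
  have hy0 : ∀ e, 0 ≤ y e := fun e => add_nonneg (hx e) (div_nonneg hK.le (hqe e).le)
  have hstep : ∀ e, y (e + f) ≤ η * y e := by
    intro e
    have h1 : D / q ^ e + K / q ^ (e + f) ≤ η * (K / q ^ e) := by
      have h2 : K / q ^ (e + f) ≤ K / q ^ e / 2 := by
        rw [pow_add, ← div_div]
        exact div_le_div_of_nonneg_left (div_nonneg hK.le (hqe e).le) (by norm_num) hqf
      have h3 : D / q ^ e ≤ K / q ^ e / 4 := by
        rw [div_div, mul_comm, ← div_div]
        exact div_le_div_of_nonneg_right (by simp only [K]; linarith) (hqe e).le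
      have h4 : 3 / 4 * (K / q ^ e) ≤ η * (K / q ^ e) :=
        mul_le_mul_of_nonneg_right (le_max_right _ _) (div_nonneg hK.le (hqe e).le)
      linarith
    have h5 : θ * x e ≤ η * x e := mul_le_mul_of_nonneg_right (le_max_left _ _) (hx e)
    have := h e
    simp only [y]
    rw [mul_add]
    linarith
  have hyB : ∀ e, y e ≤ B + K := fun e =>
    add_le_add (hB e) (div_le_self hK.le (one_le_pow₀ (by linarith)))
  have hiter : ∀ j e, y (e + f * j) ≤ η ^ j * (B + K) := by
    intro j
    induction j with
    | zero => intro e; simpa using hyB e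
    | succ j ih =>
      intro e
      calc y (e + f * (j + 1)) = y ((e + f * j) + f) := by rw [mul_add, mul_one, add_assoc]
        _ ≤ η * y (e + f * j) := hstep _
        _ ≤ η * (η ^ j * (B + K)) := mul_le_mul_of_nonneg_left (ih e) hη0
        _ = _ := by ring
  have hlim : Tendsto (fun e : ℕ => η ^ (e / f) * (B + K)) atTop (𝓝 0) := by
    have h1 := (tendsto_pow_atTop_nhds_zero_of_lt_one hη0 hη).comp
      (Nat.tendsto_div_const_atTop hf.ne')
    simpa using h1.mul_const (B + K)
  refine squeeze_zero hx (fun e => ?_) hlim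
  have h1 := hiter (e / f) (e % f)
  rw [Nat.mod_add_div] at h1
  exact (le_add_of_nonneg_right (div_nonneg hK.le (hqe e).le)).trans h1

/-- The limit is the supremum: a term close to it bounds from below all terms at least m places
further on. -/
theorem exists_tendsto_of_eventually_le_add {u : ℕ → ℝ} {B : ℝ} (hB : ∀ j, u j ≤ B) {m : ℕ}
    (hu : ∀ k ≥ m, ∀ j, u j ≤ u (j + k)) : ∃ s, Tendsto u atTop (𝓝 s) := by
  have hbdd : BddAbove (Set.range u) := ⟨B, by rintro _ ⟨j, rfl⟩; exact hB j⟩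
  refine ⟨⨆ j, u j, tendsto_order.2 ⟨fun a ha => ?_, fun a ha => ?_⟩⟩
  · obtain ⟨j, hj⟩ := exists_lt_of_lt_ciSup ha
    filter_upwards [eventually_ge_atTop (j + m)] with i hi
    have := hu (i - j) (by omega) j
    rw [Nat.add_sub_cancel' (by omega)] at this
    exact hj.trans_le this
  · exact Eventually.of_forall fun i => (le_ciSup hbdd i).trans_lt ha

/-- A bounded sequence that increases up to a geometric error along a numerical semigroup
converges. -/
theorem exists_tendsto_of_le_add_div_pow {q : ℝ} (hq : 2 ≤ q) {b : ℕ → ℝ} {B : ℝ}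
    (hB : ∀ e, b e ≤ B) {n m : ℕ} (hn : 0 < n)
    (h : ∀ k ≥ m, 0 < k → ∃ D : ℝ, 0 ≤ D ∧ ∀ e, b e ≤ b (e + k * n) + D / q ^ e) :
    ∃ s, Tendsto (fun j => b (j * n)) atTop (𝓝 s) := by
  have hq0 : (0 : ℝ) < q := by linarith
  have hqe : ∀ e : ℕ, 0 < q ^ e := fun e => pow_pos hq0 e
  have h' : ∀ k ≥ m + 1, ∃ D : ℝ, 0 ≤ D ∧ ∀ e, b e ≤ b (e + k * n) + D / q ^ e :=
    fun k hk => h k (by omega) (by omega)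
  choose! D hD0 hD using h'
  -- Every k ≥ m + 1 is a sum of numbers in [m + 1, 2m + 2), so only finitely many constants `D k`
  -- matter. With 2 D_k ≤ K for these, subtracting K/q^e makes the inequalities exact.
  let K : ℝ := 2 * ∑ k ∈ Finset.range (2 * (m + 1)), |D k|
  have hK0 : 0 ≤ K := by positivity
  have hK : ∀ k ≥ m + 1, k < 2 * (m + 1) → 2 * D k ≤ K := by
    intro k _ hk2
    refine mul_le_mul_of_nonneg_left ((le_abs_self _).trans ?_) (by norm_num)
    exact Finset.single_le_sum (f := fun k => |D k|) (fun i _ => abs_nonneg _)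
      (Finset.mem_range.2 hk2)
  let c : ℕ → ℝ := fun e => b e - K / q ^ e
  have hc : ∀ k ≥ m + 1, k < 2 * (m + 1) → ∀ e, c e ≤ c (e + k * n) := by
    intro k hk hk2 e
    have h1 := hD k hk e
    have hkn : k * n ≠ 0 := (Nat.mul_pos (by omega) hn).ne'
    have hqf : 2 ≤ q ^ (k * n) := hq.trans (le_self_pow₀ (by linarith) hkn)
    have h2 : K / q ^ (e + k * n) ≤ K / q ^ e / 2 := by
      rw [pow_add, ← div_div]
      exact div_le_div_of_nonneg_left (div_nonneg hK0 (hqe e).le) (by norm_num) hqf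
    have h3 : D k / q ^ e ≤ K / q ^ e / 2 := by
      rw [div_div, mul_comm, ← div_div]
      exact div_le_div_of_nonneg_right (by have := hK k hk hk2; linarith) (hqe e).le
    simp only [c]
    linarith
  have hc' : ∀ k ≥ m + 1, ∀ e, c e ≤ c (e + k * n) := by
    intro k
    induction k using Nat.strong_induction_on with
    | _ k ih =>
      intro hk e
      by_cases hk2 : k < 2 * (m + 1)
      · exact hc k hk hk2 e
      · have h1 := ih (k - (m + 1)) (by omega) (by omega) e
        have h2 := hc (m + 1) le_rfl (by omega) (e + (k - (m + 1)) * n)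
        rw [add_assoc, ← add_mul, Nat.sub_add_cancel hk] at h2
        exact h1.trans h2
  obtain ⟨s, hs⟩ := exists_tendsto_of_eventually_le_add (u := fun j => c (j * n)) (B := B)
    (fun j => (sub_le_self _ (div_nonneg hK0 (hqe _).le)).trans (hB _)) (m := m + 1)
    (fun k hk j => by simpa [add_mul] using hc' k hk (j * n))
  refine ⟨s, ?_⟩
  have h0 : Tendsto (fun j : ℕ => K / q ^ (j * n)) atTop (𝓝 0) := by
    have h1 : Tendsto (fun e : ℕ => K / q ^ e) atTop (𝓝 0) :=
      tendsto_const_nhds.div_atTop (tendsto_pow_atTop_atTop_of_one_lt (by linarith))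
    exact h1.comp (tendsto_id.atTop_mul_const' hn)
  simpa [c] using hs.add h0

namespace CartierModule

variable {p : ℕ} [Fact p.Prime] {R : Type u} [CommRing R] [IsLocalRing R] [CharP R p]
  {C : CartierAlgebra.{u, w} p R} (ρ : CartierModule C R) [IsNoetherianRing R]

/-! ### Rings with zero divisors -/

/-- With κ(s) = 1 one has r = r κ(s) = κ(r^q s), and r^q = 0 since q ≥ 2 in positive degree. -/
theorem eq_zero_of_mul_self_eq_zero {f : ℕ} (hf : 0 < f) (hsplit : ρ.splitIdeal f ≠ ⊤) {r : R}
    (hr : r * r = 0) : r = 0 := by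
  obtain ⟨x, s, hx⟩ := ρ.exists_act_eq_one hsplit
  have h1 := ρ.isCartierLinear x r s
  have h2 : r ^ p ^ f = 0 := by
    have : 2 ≤ p ^ f := (Fact.out : p.Prime).two_le.trans (Nat.le_self_pow hf.ne' p)
    rw [← Nat.sub_add_cancel this, pow_add, sq, hr, mul_zero]
  rw [h2, zero_smul, map_zero, hx, smul_eq_mul, mul_one] at h1
  exact h1.symm

/-- For z ∈ Z: z κ(r) = κ(z^q r) = 0. -/
theorem act_mem_annihilator (Z : Ideal R) {e : ℕ} (x : C.deg e) {r : R} (hr : r ∈ Z.annihilator) :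
    ρ.act e x r ∈ Z.annihilator := by
  rw [Submodule.mem_annihilator] at hr ⊢
  intro z hz
  have hq : p ^ e ≠ 0 := pow_ne_zero e (Fact.out : p.Prime).ne_zero
  rw [smul_eq_mul, mul_comm, ← smul_eq_mul, ← ρ.isCartierLinear, smul_eq_mul, mul_comm,
    ← smul_eq_mul, hr _ (Z.pow_mem_of_mem hz _ (Nat.pos_of_ne_zero hq)), map_zero]

/-- A proper ideal stable under 𝒞 lies in 𝔪, and so do its images under all κ. -/
theorem annihilator_le_splitIdeal {Z : Ideal R} (hZ : Z ≠ ⊥) (e : ℕ) :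
    Z.annihilator ≤ ρ.splitIdeal e := by
  intro r hr x
  refine le_maximalIdeal ?_ (ρ.act_mem_annihilator Z x hr)
  rwa [Ne, Submodule.annihilator_eq_top_iff]

/-- If `R` is not a domain, the colengths of the splitting ideals grow slowly. -/
theorem exists_colength_splitIdeal_mul_le {f : ℕ} (hf : 0 < f) (hsplit : ρ.splitIdeal f ≠ ⊤)
    (hdom : ¬ IsDomain R) :
    ∃ D : ℕ, ∀ e : ℕ, (ρ.splitIdeal e).colength * p ^ e ≤ D * (p ^ e) ^ krullDimNat R := by
  have hred : ∀ r : R, r * r = 0 → r = 0 := fun r => ρ.eq_zero_of_mul_self_eq_zero hf hsplit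
  obtain ⟨x, y, hxy, hx, hy⟩ : ∃ x y : R, x * y = 0 ∧ x ≠ 0 ∧ y ≠ 0 := by
    by_contra! hcon
    have : NoZeroDivisors R := ⟨fun {a b} hab => or_iff_not_imp_left.2 (hcon a b hab)⟩
    exact hdom (NoZeroDivisors.to_isDomain R)
  let X : Ideal R := Ideal.span {x}
  have hX : X ≠ ⊥ := by rwa [Ne, Ideal.span_singleton_eq_bot]
  have hA : X.annihilator ≠ ⊥ := by
    intro h
    have : y ∈ X.annihilator := by
      rw [Submodule.mem_annihilator_span_singleton, smul_eq_mul, mul_comm, hxy]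
    rw [h] at this
    exact hy this
  let A : Ideal R := X.annihilator
  -- If A + Ann A consisted of zero divisors, some z ≠ 0 would kill it. Then z ∈ Ann A is killed by
  -- itself, against reducedness.
  obtain ⟨c, hcJ, hc⟩ : ∃ c ∈ A ⊔ Submodule.annihilator A, c ∈ nonZeroDivisors R := by
    by_contra! hcon
    have hdisj : Disjoint ((A ⊔ Submodule.annihilator A : Ideal R) : Set R) (nonZeroDivisors R) :=
      Set.disjoint_left.2 hcon
    obtain ⟨z, hz, hz0⟩ := SetLike.exists_of_lt
      (Ideal.bot_lt_annihilator_of_disjoint_nonZeroDivisors hdisj)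
    have hz' : ∀ w ∈ A ⊔ Submodule.annihilator A, z * w = 0 := fun w hw =>
      (Submodule.mem_annihilator (N := (A ⊔ Submodule.annihilator A))).1 hz w hw
    have hzA : z ∈ Submodule.annihilator A :=
      Submodule.mem_annihilator.2 fun w hw => hz' w (Ideal.mem_sup_left hw)
    exact hz0 (hred z (hz' z (Ideal.mem_sup_right hzA)))
  have hle : ∀ e, A ⊔ Submodule.annihilator A ≤ ρ.splitIdeal e := fun e =>
    sup_le (ρ.annihilator_le_splitIdeal hX e) (ρ.annihilator_le_splitIdeal hA e)
  let v : R →ₗ[R] R := LinearMap.mulLeft R c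
  obtain ⟨D, hD⟩ := exists_length_quotient_frobeniusPower_mul_le p (R ⧸ LinearMap.range v) hc
    (fun n => by
      obtain ⟨y, rfl⟩ := Submodule.mkQ_surjective _ n
      rw [← map_smul, Submodule.mkQ_apply, Submodule.Quotient.mk_eq_zero]
      exact ⟨y, rfl⟩)
  refine ⟨D, fun e => ?_⟩
  -- Multiplication by c maps all of R into I_e, so only the cokernel R/(c) counts.
  have h := Module.length_quotient_le_add_coker v (M' := ⊤) (P' := ρ.splitIdeal e)
    (fun r _ => Ideal.mul_mem_right _ _ (hle e hcJ)) (frobeniusPower R p e)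
    (by rw [smul_eq_mul, Ideal.mul_top]; exact ρ.frobeniusPower_le_splitIdeal e)
  rw [Module.length_eq_zero (M := R ⧸ (⊤ : Submodule R R)), zero_add,
    ← Ideal.coe_colength p (ρ.frobeniusPower_le_splitIdeal e)] at h
  exact_mod_cast (mul_le_mul_left h ((p : ℕ∞) ^ e)).trans (hD e)

/-! ### The period -/

theorem splittingPeriod_eq_setGcd :
    ρ.splittingPeriod = Nat.setGcd {e | ρ.splittingNumber e ≠ 0} := by
  have h : {d : ℕ | ∀ e : ℕ, ρ.splittingNumber e ≠ 0 → d ∣ e} =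
      {d | d ∣ Nat.setGcd {e | ρ.splittingNumber e ≠ 0}} := by
    ext d
    exact (Nat.dvd_setGcd_iff (s := {e | ρ.splittingNumber e ≠ 0})).symm
  rw [splittingPeriod, h]
  rcases Nat.eq_zero_or_pos (Nat.setGcd {e | ρ.splittingNumber e ≠ 0}) with h0 | hpos
  · rw [h0]
    -- Every number divides 0, so the set is unbounded and its supremum takes the default value 0.
    refine Nat.sSup_of_not_bddAbove fun ⟨B, hB⟩ => ?_
    exact absurd (hB (show B + 1 ∣ 0 from dvd_zero _)) (by omega)
  · refine le_antisymm (csSup_le ⟨_, dvd_rfl⟩ fun d hd => Nat.le_of_dvd hpos hd)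
      (le_csSup ⟨_, fun d hd => Nat.le_of_dvd hpos hd⟩ dvd_rfl)

/-- The degrees with proper splitting ideal form a submonoid of ℕ, which contains all large
multiples of its gcd. -/
theorem exists_splitIdeal_mul_period_ne_top (hF : (frobenius R p).Finite) :
    ∃ m, ∀ k ≥ m, 0 < k → ρ.splitIdeal (k * ρ.splittingPeriod) ≠ ⊤ := by
  obtain ⟨m, hm⟩ := Nat.exists_mem_closure_of_ge {e | ρ.splittingNumber e ≠ 0}
  rw [← splittingPeriod_eq_setGcd] at hm
  have h0 : ρ.splitIdeal 0 ≠ ⊤ := by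
    rw [Ideal.ne_top_iff_one]
    intro h
    have := h (C.coeff 1)
    rw [ρ.act_coeff, one_smul] at this
    exact (Ideal.ne_top_iff_one _).1 Ideal.IsPrime.ne_top' this
  have hcl : ∀ e ∈ AddSubmonoid.closure {e | ρ.splittingNumber e ≠ 0}, ρ.splitIdeal e ≠ ⊤ := by
    intro e he
    induction he using AddSubmonoid.closure_induction with
    | mem e he => exact (ρ.splittingNumber_ne_zero_iff hF e).1 he
    | zero => exact h0
    | add e f _ _ he hf => exact ρ.splitIdeal_add_ne_top he hf
  refine ⟨m, fun k hk _ => ?_⟩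
  rcases Nat.eq_zero_or_pos ρ.splittingPeriod with hn | hn
  · rw [hn, mul_zero]; exact h0
  · exact hcl _ (hm _ (hk.trans (Nat.le_mul_of_pos_right k hn)) (dvd_mul_left _ _))

theorem exists_pos_splitIdeal_ne_top (hF : (frobenius R p).Finite) (hn : ρ.splittingPeriod ≠ 0) :
    ∃ f, 0 < f ∧ ρ.splitIdeal f ≠ ⊤ := by
  obtain ⟨m, hm⟩ := ρ.exists_splitIdeal_mul_period_ne_top hF
  exact ⟨(m + 1) * ρ.splittingPeriod, Nat.mul_pos (by omega) (Nat.pos_of_ne_zero hn),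
    hm (m + 1) (by omega) (by omega)⟩

end CartierModule
end

noncomputable section

open IsLocalRing Filter Topology

/-! ### Existence of the limit -/

/-- `λ / q^d` with `q = p ^ e` and `d = dim R`. -/
def normalizedLength (p : ℕ) (R : Type*) [CommRing R] (e l : ℕ) : ℝ :=
  l / ((p : ℝ) ^ e) ^ krullDimNat R

section normalized

variable (p : ℕ) [Fact p.Prime] (R : Type*) [CommRing R]

theorem normalizedLength_nonneg (e l : ℕ) : 0 ≤ normalizedLength p R e l := by
  unfold normalizedLength; positivity

theorem normalizedLength_le {e l D : ℕ} (h : l ≤ D * (p ^ e) ^ krullDimNat R) :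
    normalizedLength p R e l ≤ D := by
  have hp : (0 : ℝ) < p := by exact_mod_cast (Fact.out : p.Prime).pos
  rw [normalizedLength, div_le_iff₀ (by positivity)]
  exact_mod_cast h

/-- Division by q^{d+1} turns the integral estimates into estimates of normalized lengths with error
D/p^e. -/
theorem mul_normalizedLength_le {e l m D a b : ℕ}
    (h : a * l * p ^ e ≤ b * m * p ^ e + D * (p ^ e) ^ krullDimNat R) :
    a * normalizedLength p R e l ≤ b * normalizedLength p R e m + D / (p : ℝ) ^ e := by
  have hp : (0 : ℝ) < p := by exact_mod_cast (Fact.out : p.Prime).pos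
  have h' : (a * l * p ^ e : ℝ) ≤ b * m * p ^ e + D * (p ^ e) ^ krullDimNat R := by
    exact_mod_cast h
  rw [normalizedLength, normalizedLength, ← mul_div_assoc, ← mul_div_assoc,
    div_add_div _ _ (by positivity) (by positivity), div_le_div_iff₀ (by positivity) (by positivity)]
  have hpos : (0 : ℝ) ≤ ((p : ℝ) ^ e) ^ krullDimNat R := by positivity
  calc _ = (a * l * p ^ e : ℝ) * (((p : ℝ) ^ e) ^ krullDimNat R) := by ring
    _ ≤ (b * m * p ^ e + D * (p ^ e) ^ krullDimNat R) * (((p : ℝ) ^ e) ^ krullDimNat R) :=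
      mul_le_mul_of_nonneg_right h' hpos
    _ = _ := by ring

theorem normalizedLength_add (e f l : ℕ) :
    normalizedLength p R e l = ((p : ℝ) ^ f) ^ krullDimNat R * normalizedLength p R (e + f) l := by
  have hp : (0 : ℝ) < p := by exact_mod_cast (Fact.out : p.Prime).pos
  rw [normalizedLength, normalizedLength, pow_add, mul_pow]
  field_simp

theorem tendsto_div_prime_pow (D : ℝ) : Tendsto (fun e : ℕ => D / (p : ℝ) ^ e) atTop (𝓝 0) :=
  tendsto_const_nhds.div_atTop (tendsto_pow_atTop_atTop_of_one_lt
    (by exact_mod_cast (Fact.out : p.Prime).one_lt))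

end normalized

namespace CartierModule

variable {p : ℕ} [Fact p.Prime] {R : Type u} [CommRing R] [IsLocalRing R] [CharP R p]
  {C : CartierAlgebra.{u, w} p R} (ρ : CartierModule C R) [IsNoetherianRing R]

theorem tendsto_normalizedLength_of_not_isDomain (hF : (frobenius R p).Finite)
    (hn : ρ.splittingPeriod ≠ 0) (hdom : ¬ IsDomain R) :
    Tendsto (fun e => normalizedLength p R e (ρ.splitIdeal e).colength) atTop (𝓝 0) := by
  obtain ⟨f, hf, hsplit⟩ := ρ.exists_pos_splitIdeal_ne_top hF hn
  obtain ⟨D, hD⟩ := ρ.exists_colength_splitIdeal_mul_le hf hsplit hdom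
  refine squeeze_zero (fun e => normalizedLength_nonneg p R e _) (fun e => ?_)
    (tendsto_div_prime_pow p D)
  have h := mul_normalizedLength_le p R (e := e) (a := 1) (b := 0) (m := 0) (D := D)
    (l := (ρ.splitIdeal e).colength) (by simpa using hD e)
  simpa using h

theorem exists_tendsto_normalizedLength_of_isDomain (hF : (frobenius R p).Finite)
    (hn : ρ.splittingPeriod ≠ 0) [IsDomain R] :
    ∃ s, Tendsto (fun j => normalizedLength p R (j * ρ.splittingPeriod)
      (ρ.splitIdeal (j * ρ.splittingPeriod)).colength) atTop (𝓝 s) := by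
  have hp2 : (2 : ℝ) ≤ p := by exact_mod_cast (Fact.out : p.Prime).two_le
  have hp0 : (0 : ℝ) < p := by linarith
  have hA : 0 < FrobPush.residueDegree p R :=
    Nat.pos_of_ne_zero (FrobPush.length_residueField_one p hF).2
  have hA' : (0 : ℝ) < FrobPush.residueDegree p R := by exact_mod_cast hA
  obtain ⟨B, hB⟩ := exists_colength_frobeniusPower_le (R := R) p
  have hB' : ∀ (e : ℕ) (I : Ideal R), frobeniusPower R p e ≤ I →
      normalizedLength p R e I.colength ≤ B := fun e I hI =>
    normalizedLength_le p R (by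
      have := hB e I hI
      rw [← Ideal.coe_colength p hI] at this
      exact_mod_cast this)
  -- The exact rank of F^f_* R is not needed. If it falls below [k : k^p]^f p^{fd} for some f, the
  -- normalized colengths of 𝔪^[q] contract to 0 and dominate those of I_e; otherwise the normalized
  -- colengths of I_e almost increase.
  by_cases hrank : ∃ f, 0 < f ∧ Module.finrank R (FrobPush p f R) <
      FrobPush.residueDegree p R ^ f * (p ^ f) ^ krullDimNat R
  · refine ⟨0, ?_⟩
    obtain ⟨f, hf, hlt⟩ := hrank
    obtain ⟨D, hD⟩ := exists_colength_frobeniusPower_add_le p hF f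
    set r := Module.finrank R (FrobPush p f R)
    set q : ℝ := (FrobPush.residueDegree p R : ℝ) ^ f * ((p : ℝ) ^ f) ^ krullDimNat R with hq
    have hq0 : 0 < q := by positivity
    have hq1 : 1 ≤ q := by
      have : 1 ≤ FrobPush.residueDegree p R ^ f * (p ^ f) ^ krullDimNat R :=
        Nat.succ_le_of_lt (lt_of_le_of_lt (Nat.zero_le _) hlt)
      rw [hq]; exact_mod_cast this
    have hθ : (r : ℝ) / q < 1 := by
      rw [div_lt_one hq0, hq]; exact_mod_cast hlt
    have hx : Tendsto (fun e => normalizedLength p R e (frobeniusPower R p e).colength)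
        atTop (𝓝 0) := by
      refine tendsto_zero_of_contracting_add hp2 (fun e => normalizedLength_nonneg p R e _)
        (fun e => hB' e _ le_rfl) hf (θ := r / q) (D := D) (by positivity) hθ (by positivity)
        fun e => ?_
      have h1 := mul_normalizedLength_le p R (e := e) (D := D)
        (a := FrobPush.residueDegree p R ^ f) (l := (frobeniusPower R p (e + f)).colength)
        (b := r) (m := (frobeniusPower R p e).colength)
        (by rw [mul_comm (FrobPush.residueDegree p R ^ f)]; exact hD e)
      rw [normalizedLength_add p R e f, ← mul_assoc] at h1
      push_cast at h1
      rw [← hq] at h1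
      have h2 : normalizedLength p R (e + f) (frobeniusPower R p (e + f)).colength ≤
          (r * normalizedLength p R e (frobeniusPower R p e).colength + D / (p : ℝ) ^ e) / q := by
        rw [le_div_iff₀ hq0, mul_comm]; exact h1
      refine h2.trans ?_
      rw [add_div, div_mul_eq_mul_div]
      exact add_le_add_right (div_le_self (by positivity) hq1) _
    have hle : ∀ e, normalizedLength p R e (ρ.splitIdeal e).colength ≤
        normalizedLength p R e (frobeniusPower R p e).colength := by
      intro e
      unfold normalizedLength
      gcongr
      have := Module.length_quotient_anti (M := R) (ρ.frobeniusPower_le_splitIdeal e)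
      rw [← Ideal.coe_colength p (ρ.frobeniusPower_le_splitIdeal e),
        ← Ideal.coe_colength p (le_refl (frobeniusPower R p e))] at this
      exact_mod_cast this
    exact (squeeze_zero (fun e => normalizedLength_nonneg p R e _) hle hx).comp
      (tendsto_id.atTop_mul_const' (Nat.pos_of_ne_zero hn))
  · push Not at hrank
    obtain ⟨m, hm⟩ := ρ.exists_splitIdeal_mul_period_ne_top hF
    refine exists_tendsto_of_le_add_div_pow hp2
      (b := fun e => normalizedLength p R e (ρ.splitIdeal e).colength)
      (fun e => hB' e _ (ρ.frobeniusPower_le_splitIdeal e)) (Nat.pos_of_ne_zero hn) (m := m)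
      fun k hk hk0 => ?_
    set f := k * ρ.splittingPeriod
    have hf : 0 < f := Nat.mul_pos hk0 (Nat.pos_of_ne_zero hn)
    obtain ⟨D, hD⟩ := ρ.exists_rank_mul_colength_le hF (hm k hk hk0)
    refine ⟨D, by positivity, fun e => ?_⟩
    set q : ℝ := (FrobPush.residueDegree p R : ℝ) ^ f * ((p : ℝ) ^ f) ^ krullDimNat R with hq
    have hq0 : 0 < q := by positivity
    have hr := hrank f hf
    have hq1 : 1 ≤ q := by
      have : 1 ≤ FrobPush.residueDegree p R ^ f * (p ^ f) ^ krullDimNat R :=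
        Nat.mul_pos (pow_pos hA f) (pow_pos (pow_pos (Fact.out : p.Prime).pos f) _)
      rw [hq]; exact_mod_cast this
    have hr' : q ≤ Module.finrank R (FrobPush p f R) := by rw [hq]; exact_mod_cast hr
    have h1 := mul_normalizedLength_le p R (e := e) (D := D)
        (b := FrobPush.residueDegree p R ^ f) (m := (ρ.splitIdeal (e + f)).colength)
        (a := Module.finrank R (FrobPush p f R)) (l := (ρ.splitIdeal e).colength)
        (by rw [mul_comm (FrobPush.residueDegree p R ^ f)]; exact hD e)
    rw [normalizedLength_add p R e f (ρ.splitIdeal (e + f)).colength, ← mul_assoc] at h1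
    push_cast at h1
    rw [← hq] at h1
    have h2 : q * normalizedLength p R e (ρ.splitIdeal e).colength ≤
        q * normalizedLength p R (e + f) (ρ.splitIdeal (e + f)).colength + D / (p : ℝ) ^ e :=
      (mul_le_mul_of_nonneg_right hr' (normalizedLength_nonneg p R e _)).trans h1
    have h3 : (D : ℝ) / (p : ℝ) ^ e ≤ q * (D / (p : ℝ) ^ e) :=
      le_mul_of_one_le_left (by positivity) hq1
    exact le_of_mul_le_mul_left (by rw [mul_add]; linarith) hq0

/-- The normalization in the `F`-signature. -/
theorem prime_pow_rpow_fSigExponent (hF : (frobenius R p).Finite) (e : ℕ) :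
    ((p : ℝ) ^ e) ^ fSigExponent p R =
      ((p : ℝ) ^ e) ^ krullDimNat R * (FrobPush.residueDegree p R : ℝ) ^ e := by
  have hp1 : (1 : ℝ) < p := by exact_mod_cast (Fact.out : p.Prime).one_lt
  have hp0 : (0 : ℝ) < p := by linarith
  have hA' : (0 : ℝ) < FrobPush.residueDegree p R := by
    exact_mod_cast Nat.pos_of_ne_zero (FrobPush.length_residueField_one p hF).2
  have h : fSigExponent p R = (krullDimNat R : ℝ) + Real.logb p (FrobPush.residueDegree p R) := rfl
  rw [h, Real.rpow_add (by positivity), Real.rpow_natCast]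
  congr 1
  rw [← Real.rpow_natCast (p : ℝ) e, ← Real.rpow_mul hp0.le, mul_comm, Real.rpow_mul hp0.le,
    Real.rpow_logb hp0 hp1.ne' hA', Real.rpow_natCast]

theorem splittingNumber_div_eq (hF : (frobenius R p).Finite) (e : ℕ) :
    (ρ.splittingNumber e : ℝ) / ((p : ℝ) ^ e) ^ fSigExponent p R =
      normalizedLength p R e (ρ.splitIdeal e).colength := by
  have hA' : (FrobPush.residueDegree p R : ℝ) ^ e ≠ 0 :=
    pow_ne_zero e (by exact_mod_cast (FrobPush.length_residueField_one p hF).2)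
  rw [prime_pow_rpow_fSigExponent hF, ρ.splittingNumber_eq hF, normalizedLength]
  push_cast
  exact mul_div_mul_right _ _ hA'

end CartierModule
end

noncomputable section

open IsLocalRing Filter Topology

/-! ### Finite local extensions: numerical invariants -/

/-- Incomparability gives one inequality, lying over and going up the other. -/
theorem ringKrullDim_eq_of_isIntegral_of_injective (R S : Type*) [CommRing R] [CommRing S]
    [Algebra R S] [Algebra.IsIntegral R S] (h : Function.Injective (algebraMap R S)) :
    ringKrullDim S = ringKrullDim R := by
  apply le_antisymm
  · refine Order.krullDim_le_of_strictMono (PrimeSpectrum.comap (algebraMap R S)) ?_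
    intro P Q hPQ
    exact Ideal.IsIntegral.comap_lt_comap (R := R) (I := P.asIdeal) (J := Q.asIdeal) hPQ
  · have hf : FaithfulSMul R S := (faithfulSMul_iff_algebraMap_injective R S).2 h
    refine iSup_le fun l => ?_
    obtain ⟨P, hP, hPl⟩ := (Ideal.nonempty_primesOver (S := S) l.head.asIdeal)
    obtain ⟨L, hL, -, -⟩ := Ideal.exists_ltSeries_of_hasGoingUp l P
    rw [← hL]
    exact le_iSup (fun l : LTSeries (PrimeSpectrum S) => (l.length : WithBot ℕ∞)) L

/-- The Frobenius of S composed with R → S is R → S composed with the Frobenius of R, which is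
finite. -/
theorem RingHom.Finite.frobenius_of_finite {p : ℕ} [Fact p.Prime] {R S : Type*} [CommRing R]
    [CharP R p] [CommRing S] [CharP S p] [Algebra R S] [Module.Finite R S]
    (hF : (frobenius R p).Finite) : (frobenius S p).Finite := by
  have h : (frobenius S p).comp (algebraMap R S) = (algebraMap R S).comp (frobenius R p) := by
    ext r
    simp [frobenius_def]
  have h2 : ((frobenius S p).comp (algebraMap R S)).Finite := by
    rw [h]
    exact RingHom.Finite.comp (RingHom.finite_algebraMap.2 inferInstance) hF
  exact h2.of_comp_finite

section

variable {p : ℕ} [Fact p.Prime] {R : Type u} [CommRing R] [IsLocalRing R] [CharP R p]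
  {S : Type v} [CommRing S] [IsLocalRing S] [CharP S p] [Algebra R S]
  [IsLocalHom (algebraMap R S)] [Module.Finite R S]

variable (R) in
theorem length_eq_mul_finrank_residueField (M : Type*) [AddCommGroup M] [Module R M] [Module S M]
    [IsScalarTower R S M] : Module.length R M =
      Module.length S M * Module.finrank (ResidueField R) (ResidueField S) := by
  rw [length_restrictScalars R S M, Module.length_eq_finrank]

theorem krullDimNat_eq (hRS : Function.Injective (algebraMap R S)) :
    krullDimNat S = krullDimNat R := by
  rw [krullDimNat, krullDimNat, ringKrullDim_eq_of_isIntegral_of_injective R S hRS]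

end

/-! ### Transposition and splitting ideals -/

section transpose

variable {p : ℕ} [Fact p.Prime] {R : Type u} [CommRing R] [CharP R p]
  {S : Type v} [CommRing S] [Algebra R S]
  {C : CartierAlgebra.{u, w} p R} {ρ : CartierModule C R}
  {σ : S →ₗ[S] UpperShriek R S R}

theorem apply_eq_apply_one_mul (s t : S) : σ s t = σ 1 (s * t) := by
  rw [← UpperShriek.smul_apply, ← map_smul, smul_eq_mul, mul_one]

/-- The working form of transposability, with σ expressed through T = `σ 1`. -/
theorem apply_one_transpose_mul (hT : IsTransposable σ ρ) {e : ℕ} (x : C.deg e) (s t : S) :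
    σ 1 (transpose hT x s * t) = ρ.act e x (σ 1 (s * t ^ p ^ e)) := by
  rw [← apply_eq_apply_one_mul, transpose_spec, apply_eq_apply_one_mul]

theorem apply_one_transpose (hT : IsTransposable σ ρ) {e : ℕ} (x : C.deg e) (s : S) :
    σ 1 (transpose hT x s) = ρ.act e x (σ 1 s) := by
  have := apply_one_transpose_mul hT x s 1
  rwa [one_pow, mul_one, mul_one] at this

theorem transposeModule_act_tmul (hσ : Function.Injective σ) (hT : IsTransposable σ ρ) {e : ℕ}
    (x : C.deg e) (s t : S) :
    (transposeModule hσ hT).act e (x ⊗ₜ[R] s : C.deg e ⊗[R] S) t = transpose hT x (s * t) := rfl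

/-- To prove that the action of `f^* 𝒞` maps `t` into a subgroup it suffices to consider pure
tensors. -/
theorem transposeModule_act_mem (hσ : Function.Injective σ) (hT : IsTransposable σ ρ)
    {e : ℕ} {H : AddSubgroup S} {t : S} (h : ∀ (x : C.deg e) (s : S), transpose hT x (s * t) ∈ H)
    (y : (C.pullback S).deg e) : (transposeModule hσ hT).act e y t ∈ H := by
  induction (show C.deg e ⊗[R] S from y) using TensorProduct.induction_on with
  | zero =>
    rw [show (transposeModule hσ hT).act e (0 : C.deg e ⊗[R] S) = 0 from map_zero _]
    exact H.zero_mem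
  | tmul x s => exact h x s
  | add a b ha hb =>
    rw [show (transposeModule hσ hT).act e (a + b : C.deg e ⊗[R] S) =
      (transposeModule hσ hT).act e a + (transposeModule hσ hT).act e b from map_add _ _ _]
    exact H.add_mem ha hb

/-- The form `(s, t) ↦ T(st)`. -/
def mulForm (σ : S →ₗ[S] UpperShriek R S R) : S →ₗ[R] S →ₗ[R] R :=
  LinearMap.mk₂ R (fun s t => σ 1 (s * t))
    (fun s s' t => by rw [add_mul, map_add])
    (fun r s t => by rw [smul_mul_assoc, map_smul])
    (fun s t t' => by rw [mul_add, map_add])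
    (fun r s t => by rw [mul_smul_comm, map_smul])

theorem mulForm_injective (hσ : Function.Injective σ) : Function.Injective (mulForm σ) := by
  intro s s' h
  apply hσ
  ext t
  rw [apply_eq_apply_one_mul, apply_eq_apply_one_mul s']
  exact congrArg (fun l : S →ₗ[R] R => l t) h

variable [IsLocalRing R] [IsLocalRing S]

/-- If s is a unit, then T(sS) = T(S) = R is not inside 𝔪. -/
theorem mem_maximalIdeal_iff_forall_apply (hsurj : Function.Surjective (σ 1))
    (hmax : ∀ s ∈ maximalIdeal S, σ 1 s ∈ maximalIdeal R) (s : S) :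
    s ∈ maximalIdeal S ↔ ∀ t, σ 1 (s * t) ∈ maximalIdeal R := by
  refine ⟨fun hs t => hmax _ (Ideal.mul_mem_right _ _ hs), fun h => ?_⟩
  by_contra hs
  rw [mem_maximalIdeal, mem_nonunits_iff, not_not] at hs
  obtain ⟨b, hb⟩ := hs.exists_right_inv
  obtain ⟨z, hz⟩ := hsurj 1
  have := h (b * z)
  rw [← mul_assoc, hb, one_mul, hz] at this
  exact (Ideal.ne_top_iff_one _).1 Ideal.IsPrime.ne_top' this

/-- By the description of 𝔫 through T, κ^⊤(as) ∈ 𝔫 means T(κ^⊤(as) t) = κ(T(s a t^q)) ∈ 𝔪 for all t.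
-/
theorem mem_splitIdeal_transposeModule [CharP S p] (hσ : Function.Injective σ)
    (hT : IsTransposable σ ρ) (hsurj : Function.Surjective (σ 1))
    (hmax : ∀ s ∈ maximalIdeal S, σ 1 s ∈ maximalIdeal R) {e : ℕ} {s : S} :
    s ∈ (transposeModule hσ hT).splitIdeal e ↔ ∀ t, σ 1 (s * t) ∈ ρ.splitIdeal e := by
  constructor
  · intro h t x
    have h1 : transpose hT x (t * s) ∈ maximalIdeal S := h (x ⊗ₜ[R] t : C.deg e ⊗[R] S)
    rw [← apply_one_transpose hT, mul_comm]
    exact hmax _ h1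
  · intro h y
    refine transposeModule_act_mem hσ hT (H := (maximalIdeal S).toAddSubgroup) (fun x a => ?_) y
    refine (mem_maximalIdeal_iff_forall_apply hsurj hmax _).2 fun t => ?_
    rw [apply_one_transpose_mul, mul_comm a s, mul_assoc]
    exact h _ x

theorem splitIdeal_transposeModule_eq_top_iff [CharP S p] (hσ : Function.Injective σ)
    (hT : IsTransposable σ ρ) (hsurj : Function.Surjective (σ 1))
    (hmax : ∀ s ∈ maximalIdeal S, σ 1 s ∈ maximalIdeal R) (e : ℕ) :
    (transposeModule hσ hT).splitIdeal e = ⊤ ↔ ρ.splitIdeal e = ⊤ := by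
  rw [Ideal.eq_top_iff_one, Ideal.eq_top_iff_one,
    mem_splitIdeal_transposeModule hσ hT hsurj hmax]
  simp only [one_mul]
  constructor
  · intro h
    obtain ⟨z, hz⟩ := hsurj 1
    exact hz ▸ h z
  · intro h t
    rw [(Ideal.eq_top_iff_one _).2 h]
    trivial

variable [IsNoetherianRing R] [CharP S p] [Module.Finite R S]

/-- The `R`-length of `S` modulo the `e`-th splitting ideal. -/
def relColength (hσ : Function.Injective σ) (hT : IsTransposable σ ρ) (e : ℕ) : ℕ :=
  (Module.length R (S ⧸ ((transposeModule hσ hT).splitIdeal e).restrictScalars R)).toNat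

theorem linearCombination_mem_splitIdeal (hσ : Function.Injective σ) (hT : IsTransposable σ ρ)
    (hsurj : Function.Surjective (σ 1)) (hmax : ∀ s ∈ maximalIdeal S, σ 1 s ∈ maximalIdeal R)
    {n : ℕ} (g : Fin n → S) (e : ℕ) :
    (Submodule.pi Set.univ fun _ => ρ.splitIdeal e) ≤
      (((transposeModule hσ hT).splitIdeal e).restrictScalars R).comap
        (Fintype.linearCombination R g) := by
  intro m hm
  rw [Submodule.mem_comap, Fintype.linearCombination_apply]
  refine Submodule.sum_mem _ fun i _ => ?_
  rw [Submodule.restrictScalars_mem, mem_splitIdeal_transposeModule hσ hT hsurj hmax]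
  intro t
  rw [smul_mul_assoc, map_smul]
  exact Ideal.mul_mem_right _ _ (hm i trivial)

/-- A surjection Rⁿ → S carries n copies of I_e into the splitting ideal of S. The crude bound gives
finiteness, and it suffices when R is not a domain. -/
theorem exists_length_quotient_splitIdeal_le (hσ : Function.Injective σ) (hT : IsTransposable σ ρ)
    (hsurj : Function.Surjective (σ 1)) (hmax : ∀ s ∈ maximalIdeal S, σ 1 s ∈ maximalIdeal R) :
    ∃ n : ℕ, ∀ e : ℕ,
      Module.length R (S ⧸ ((transposeModule hσ hT).splitIdeal e).restrictScalars R) ≤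
        (n * (ρ.splitIdeal e).colength : ℕ) := by
  obtain ⟨n, g, hg⟩ := Module.Finite.exists_fin (R := R) (M := S)
  refine ⟨n, fun e => ?_⟩
  have h := Module.length_quotient_le_add (Fintype.linearCombination R g)
    (linearCombination_mem_splitIdeal hσ hT hsurj hmax g e)
  rw [Fintype.range_linearCombination, hg, sup_top_eq,
    Module.length_eq_zero (M := S ⧸ (⊤ : Submodule R S)), add_zero,
    Module.length_quotient_pi_ideal,
    ← Ideal.coe_colength p (ρ.frobeniusPower_le_splitIdeal e)] at h
  exact_mod_cast h

theorem coe_relColength (hσ : Function.Injective σ) (hT : IsTransposable σ ρ)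
    (hsurj : Function.Surjective (σ 1)) (hmax : ∀ s ∈ maximalIdeal S, σ 1 s ∈ maximalIdeal R)
    (e : ℕ) : (relColength hσ hT e : ℕ∞) =
      Module.length R (S ⧸ ((transposeModule hσ hT).splitIdeal e).restrictScalars R) := by
  obtain ⟨n, hn⟩ := exists_length_quotient_splitIdeal_le hσ hT hsurj hmax
  exact ENat.natCast_toNat (ne_top_of_le_ne_top (ENat.natCast_ne_top _) (hn e))

theorem exists_relColength_le (hσ : Function.Injective σ) (hT : IsTransposable σ ρ)
    (hsurj : Function.Surjective (σ 1)) (hmax : ∀ s ∈ maximalIdeal S, σ 1 s ∈ maximalIdeal R) :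
    ∃ n : ℕ, ∀ e : ℕ, relColength hσ hT e ≤ n * (ρ.splitIdeal e).colength := by
  obtain ⟨n, hn⟩ := exists_length_quotient_splitIdeal_le hσ hT hsurj hmax
  refine ⟨n, fun e => ?_⟩
  have := hn e
  rw [← coe_relColength hσ hT hsurj hmax] at this
  exact_mod_cast this

/-- The upper bound comes from Rⁿ → S given by a maximal independent family, the lower bound from s
↦ (T(s g_i)), which has full rank because σ is injective. -/
theorem exists_relColength_le_add [IsDomain R] (hσ : Function.Injective σ)
    (hT : IsTransposable σ ρ) (hsurj : Function.Surjective (σ 1))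
    (hmax : ∀ s ∈ maximalIdeal S, σ 1 s ∈ maximalIdeal R) :
    ∃ D : ℕ, ∀ e : ℕ,
      (relColength hσ hT e * p ^ e ≤ Module.finrank R S * (ρ.splitIdeal e).colength * p ^ e +
        D * (p ^ e) ^ krullDimNat R) ∧
      (Module.finrank R S * (ρ.splitIdeal e).colength * p ^ e ≤ relColength hσ hT e * p ^ e +
        D * (p ^ e) ^ krullDimNat R) := by
  obtain ⟨g, -, c, hc, hg⟩ := Module.exists_linearIndependent_smul_mem_span R S
  obtain ⟨c', hc', hu⟩ := LinearMap.exists_smul_mem_range_pi (mulForm σ)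
    (mulForm_injective hσ) hc hg
  set u := LinearMap.pi fun i => (mulForm σ).flip (g i) with hudef
  let w := Fintype.linearCombination R g
  obtain ⟨D, hD⟩ := exists_length_quotient_frobeniusPower_mul_le p
    ((Fin (Module.finrank R S) → R) ⧸ LinearMap.range u)
    (mem_nonZeroDivisors_of_ne_zero hc') (fun n => by
      obtain ⟨y, rfl⟩ := Submodule.mkQ_surjective _ n
      rw [← map_smul, Submodule.mkQ_apply, Submodule.Quotient.mk_eq_zero]
      exact hu y)
  obtain ⟨D', hD'⟩ := exists_length_quotient_frobeniusPower_mul_le p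
    (S ⧸ LinearMap.range w)
    (mem_nonZeroDivisors_of_ne_zero hc) (fun n => by
      obtain ⟨y, rfl⟩ := Submodule.mkQ_surjective _ n
      rw [← map_smul, Submodule.mkQ_apply, Submodule.Quotient.mk_eq_zero,
        Fintype.range_linearCombination]
      exact hg y)
  refine ⟨max D D', fun e => ⟨?_, ?_⟩⟩
  · have h := Module.length_quotient_le_add_coker w
      (linearCombination_mem_splitIdeal hσ hT hsurj hmax g e) (frobeniusPower R p e)
      (Submodule.smul_le.2 fun r hr s _ => by
        rw [Submodule.restrictScalars_mem, mem_splitIdeal_transposeModule hσ hT hsurj hmax]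
        intro t
        rw [smul_mul_assoc, map_smul]
        exact Ideal.mul_mem_right _ _ (ρ.frobeniusPower_le_splitIdeal e hr))
    rw [Module.length_quotient_pi_ideal, ← coe_relColength hσ hT hsurj hmax,
      ← Ideal.coe_colength p (ρ.frobeniusPower_le_splitIdeal e)] at h
    have h2 := (mul_le_mul_left h ((p : ℕ∞) ^ e)).trans
      ((add_mul _ _ _).le.trans (add_le_add_right (hD' e) _))
    have h3 : relColength hσ hT e * p ^ e ≤
        Module.finrank R S * (ρ.splitIdeal e).colength * p ^ e + D' * (p ^ e) ^ krullDimNat R := by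
      exact_mod_cast h2
    refine h3.trans ?_
    gcongr
    exact le_max_right _ _
  · have h := Module.length_quotient_le_add_coker u
      (M' := ((transposeModule hσ hT).splitIdeal e).restrictScalars R)
      (P' := Submodule.pi Set.univ fun _ => ρ.splitIdeal e)
      (fun s hs i _ => (mem_splitIdeal_transposeModule hσ hT hsurj hmax).1 hs (g i))
      (frobeniusPower R p e) (Ideal.smul_top_le_pi (ρ.frobeniusPower_le_splitIdeal e))
    rw [Module.length_quotient_pi_ideal, ← coe_relColength hσ hT hsurj hmax,
      ← Ideal.coe_colength p (ρ.frobeniusPower_le_splitIdeal e)] at h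
    have h2 := (mul_le_mul_left h ((p : ℕ∞) ^ e)).trans
      ((add_mul _ _ _).le.trans (add_le_add_right (hD e) _))
    have h3 : Module.finrank R S * (ρ.splitIdeal e).colength * p ^ e ≤
        relColength hσ hT e * p ^ e + D * (p ^ e) ^ krullDimNat R := by
      exact_mod_cast h2
    refine h3.trans ?_
    gcongr
    exact le_max_left _ _

variable [IsLocalHom (algebraMap R S)]

theorem finrank_mul_colength_splitIdeal (hσ : Function.Injective σ) (hT : IsTransposable σ ρ)
    (hsurj : Function.Surjective (σ 1)) (hmax : ∀ s ∈ maximalIdeal S, σ 1 s ∈ maximalIdeal R)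
    (e : ℕ) : Module.finrank (ResidueField R) (ResidueField S) *
      ((transposeModule hσ hT).splitIdeal e).colength = relColength hσ hT e := by
  have hN : IsNoetherianRing S := IsNoetherianRing.of_finite R S
  have h := coe_relColength hσ hT hsurj hmax e
  rw [(Submodule.Quotient.restrictScalarsEquiv R
      ((transposeModule hσ hT).splitIdeal e)).length_eq,
    length_eq_mul_finrank_residueField R (S := S),
    ← Ideal.coe_colength p ((transposeModule hσ hT).frobeniusPower_le_splitIdeal e)] at h
  rw [mul_comm]
  exact_mod_cast h.symm

end transpose
end

noncomputable section

open IsLocalRing Filter Topology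

/-! ### The transformation rule for `F`-signatures -/

theorem finrank_fractionRing_tensorProduct (R S : Type*) [CommRing R] [IsDomain R] [CommRing S]
    [Algebra R S] :
    Module.finrank (FractionRing R) (FractionRing R ⊗[R] S) = Module.finrank R S := by
  rw [IsFractionRing.finrank_right_eq R (S := FractionRing R) (N := FractionRing R ⊗[R] S)]
  exact IsLocalizedModule.finrank_eq (nonZeroDivisors R)
    (TensorProduct.mk R (FractionRing R) S 1) le_rfl

section

variable {p : ℕ} [Fact p.Prime] {R : Type u} [CommRing R] [IsLocalRing R] [IsNoetherianRing R]
  [CharP R p] {S : Type v} [CommRing S] [IsLocalRing S] [CharP S p] [Algebra R S]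
  [IsLocalHom (algebraMap R S)] [Module.Finite R S]
  {C : CartierAlgebra.{u, w} p R} {ρ : CartierModule C R} {σ : S →ₗ[S] UpperShriek R S R}

/-- The splitting ideals of R and S are proper in the same degrees. -/
theorem splittingPeriod_transposeModule (hF : (frobenius R p).Finite)
    (hσ : Function.Injective σ) (hT : IsTransposable σ ρ)
    (hsurj : Function.Surjective (σ 1)) (hmax : ∀ s ∈ maximalIdeal S, σ 1 s ∈ maximalIdeal R) :
    (transposeModule hσ hT).splittingPeriod = ρ.splittingPeriod := by
  have hN : IsNoetherianRing S := IsNoetherianRing.of_finite R S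
  unfold CartierModule.splittingPeriod
  simp only [ρ.splittingNumber_ne_zero_iff hF,
    (transposeModule hσ hT).splittingNumber_ne_zero_iff hF.frobenius_of_finite, Ne,
    splitIdeal_transposeModule_eq_top_iff hσ hT hsurj hmax]

theorem CartierModule.hasFSignature_iff (ρ : CartierModule C R) (hF : (frobenius R p).Finite)
    (hn : ρ.splittingPeriod ≠ 0) {s : ℝ} :
    ρ.HasFSignature s ↔ Tendsto (fun j => normalizedLength p R (j * ρ.splittingPeriod)
      (ρ.splitIdeal (j * ρ.splittingPeriod)).colength) atTop (𝓝 s) := by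
  rw [HasFSignature, if_neg hn]
  simp only [ρ.splittingNumber_div_eq hF]

theorem exists_hasFSignature_transposeModule (hF : (frobenius R p).Finite)
    (hRS : Function.Injective (algebraMap R S))
    (hσ : Function.Injective σ) (hT : IsTransposable σ ρ)
    (hsurj : Function.Surjective (σ 1)) (hmax : ∀ s ∈ maximalIdeal S, σ 1 s ∈ maximalIdeal R) :
    ∃ sR sS : ℝ, ρ.HasFSignature sR ∧ (transposeModule hσ hT).HasFSignature sS ∧
      (Module.finrank (ResidueField R) (ResidueField S) : ℝ) * sS =
        (Module.finrank (FractionRing R) (FractionRing R ⊗[R] S) : ℝ) * sR := by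
  have hN : IsNoetherianRing S := IsNoetherianRing.of_finite R S
  have hper := splittingPeriod_transposeModule hF hσ hT hsurj hmax
  -- Period 0 occurs for R and S simultaneously, and both signatures are then 0 by convention.
  by_cases hn : ρ.splittingPeriod = 0
  · refine ⟨0, 0, ?_, ?_, by simp⟩
    · rw [CartierModule.HasFSignature, if_pos hn]
    · rw [CartierModule.HasFSignature, if_pos (hper.trans hn)]
  have hκ : 0 < Module.finrank (ResidueField R) (ResidueField S) := Module.finrank_pos
  have hκ' : (Module.finrank (ResidueField R) (ResidueField S) : ℝ) ≠ 0 := by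
    exact_mod_cast hκ.ne'
  have hS : ∀ e, normalizedLength p S e ((transposeModule hσ hT).splitIdeal e).colength =
      normalizedLength p R e (relColength hσ hT e) /
        Module.finrank (ResidueField R) (ResidueField S) := by
    intro e
    rw [← finrank_mul_colength_splitIdeal hσ hT hsurj hmax, normalizedLength, normalizedLength,
      krullDimNat_eq hRS]
    push_cast
    field_simp
  suffices h : ∃ s : ℝ, Tendsto (fun j => normalizedLength p R (j * ρ.splittingPeriod)
        (ρ.splitIdeal (j * ρ.splittingPeriod)).colength) atTop (𝓝 s) ∧
      Tendsto (fun j => normalizedLength p R (j * ρ.splittingPeriod)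
        (relColength hσ hT (j * ρ.splittingPeriod))) atTop
        (𝓝 (Module.finrank (FractionRing R) (FractionRing R ⊗[R] S) * s)) by
    obtain ⟨s, h1, h2⟩ := h
    refine ⟨s, Module.finrank (FractionRing R) (FractionRing R ⊗[R] S) * s /
      Module.finrank (ResidueField R) (ResidueField S), (ρ.hasFSignature_iff hF hn).2 h1, ?_,
      mul_div_cancel₀ _ hκ'⟩
    rw [(transposeModule hσ hT).hasFSignature_iff hF.frobenius_of_finite
      (by rwa [hper]), hper]
    simp only [hS]
    exact h2.div_const _
  have hmul : Tendsto (fun j : ℕ => j * ρ.splittingPeriod) atTop atTop :=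
    tendsto_id.atTop_mul_const' (Nat.pos_of_ne_zero hn)
  by_cases hdom : IsDomain R
  · obtain ⟨s, hs⟩ := ρ.exists_tendsto_normalizedLength_of_isDomain hF hn
    refine ⟨s, hs, ?_⟩
    rw [finrank_fractionRing_tensorProduct]
    obtain ⟨D, hD⟩ := exists_relColength_le_add hσ hT hsurj hmax
    -- The two one-sided comparisons bound the difference by D/p^e.
    have h0 : Tendsto (fun e => normalizedLength p R e (relColength hσ hT e) -
        Module.finrank R S * normalizedLength p R e (ρ.splitIdeal e).colength) atTop (𝓝 0) := by
      refine squeeze_zero_norm (fun e => ?_) (tendsto_div_prime_pow p D)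
      have h1 := mul_normalizedLength_le p R (e := e) (a := 1) (b := Module.finrank R S)
        (l := relColength hσ hT e) (m := (ρ.splitIdeal e).colength) (D := D)
        (by simpa using (hD e).1)
      have h2 := mul_normalizedLength_le p R (e := e) (b := 1) (a := Module.finrank R S)
        (m := relColength hσ hT e) (l := (ρ.splitIdeal e).colength) (D := D)
        (by simpa using (hD e).2)
      rw [Nat.cast_one, one_mul] at h1 h2
      rw [Real.norm_eq_abs, abs_le]
      constructor <;> linarith
    have h1 := (h0.comp hmul).add (hs.const_mul (Module.finrank R S : ℝ))
    simpa using h1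
  -- Both limits vanish here, so the value of the generic rank plays no role.
  · have h0 := ρ.tendsto_normalizedLength_of_not_isDomain hF hn hdom
    refine ⟨0, h0.comp hmul, ?_⟩
    rw [mul_zero]
    obtain ⟨m, hm⟩ := exists_relColength_le hσ hT hsurj hmax
    have h1 : Tendsto (fun e => normalizedLength p R e (relColength hσ hT e)) atTop (𝓝 0) := by
      refine squeeze_zero (fun e => normalizedLength_nonneg p R e _) (fun e => ?_)
        (by simpa using h0.const_mul (m : ℝ))
      rw [normalizedLength, normalizedLength, ← mul_div_assoc]
      gcongr
      exact_mod_cast hm e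
    exact h1.comp hmul

end
end

noncomputable section

open IsLocalRing

/-! ### Primes and common denominators -/

/-- The product of the multipliers of finitely many generators stays outside the prime η. -/
theorem Ideal.exists_notMem_forall_mul_mem {R : Type*} [CommRing R] {I K η : Ideal R}
    [η.IsPrime] (hI : I.FG) (h : ∀ c ∈ I, ∃ v, v ∉ η ∧ v * c ∈ K) :
    ∃ v, v ∉ η ∧ ∀ c ∈ I, v * c ∈ K := by
  obtain ⟨s, rfl⟩ := hI
  choose! v hv hvK using h
  refine ⟨∏ c ∈ s, v c, fun hmem => ?_, fun c hc => ?_⟩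
  · obtain ⟨c, hc, hc'⟩ := (Ideal.IsPrime.prod_mem_iff (s := s) (x := v)).1 hmem
    exact hv c (Ideal.subset_span hc) hc'
  · induction hc using Submodule.span_induction with
    | mem c hc =>
      obtain ⟨b, hb⟩ := Finset.dvd_prod_of_mem v hc
      rw [hb, mul_right_comm]
      exact K.mul_mem_right _ (hvK c (Ideal.subset_span hc))
    | zero => rw [mul_zero]; exact K.zero_mem
    | add a b _ _ ha hb => rw [mul_add]; exact K.add_mem ha hb
    | smul a b _ hb => rw [smul_eq_mul, mul_left_comm]; exact K.mul_mem_left _ hb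

/-- In the localization at Q the ideal generated by I is primary to the maximal ideal. The auxiliary
`I'` is its contraction, whose radical contains Q. -/
theorem Ideal.exists_notMem_pow_mul_mem_of_mem_minimalPrimes {R : Type*} [CommRing R]
    [IsNoetherianRing R] {I Q : Ideal R} (hQ : Q ∈ I.minimalPrimes) :
    ∃ (k : ℕ) (v : R), v ∉ Q ∧ ∀ c ∈ Q ^ k, v * c ∈ I := by
  have hprime : Q.IsPrime := hQ.1.1
  let I' : Ideal R :=
    { carrier := {a | ∃ y, y ∉ Q ∧ y * a ∈ I}
      zero_mem' := ⟨1, (Ideal.ne_top_iff_one _).1 hprime.ne_top, by rw [mul_zero]; exact I.zero_mem⟩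
      add_mem' := by
        rintro a b ⟨y, hy, hya⟩ ⟨z, hz, hzb⟩
        refine ⟨y * z, fun h => (hprime.mem_or_mem h).elim hy hz, ?_⟩
        rw [show y * z * (a + b) = z * (y * a) + y * (z * b) by ring]
        exact I.add_mem (I.mul_mem_left _ hya) (I.mul_mem_left _ hzb)
      smul_mem' := by
        rintro c a ⟨y, hy, hya⟩
        exact ⟨y, hy, by rw [smul_eq_mul, mul_left_comm]; exact I.mul_mem_left _ hya⟩ }
  have hrad : Q ≤ I'.radical := by
    intro x hx
    by_contra hcon
    -- A prime over I avoiding both the complement of Q and x ∈ Q would be strictly smaller than Q,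
    -- against minimality.
    have hdisj : Disjoint (I : Set R) ((Q.primeCompl ⊔ Submonoid.powers x : Submonoid R) : Set R) := by
      refine Set.disjoint_left.2 fun a ha ha' => ?_
      obtain ⟨y, hy, z, ⟨n, rfl⟩, rfl⟩ := Submonoid.mem_sup.1 ha'
      exact hcon ⟨n, y, hy, ha⟩
    obtain ⟨P, hP, hIP, hdisj'⟩ := Ideal.exists_le_prime_disjoint I _ hdisj
    have hPQ : P ≤ Q := fun a ha => by
      by_contra haQ
      exact Set.disjoint_left.1 hdisj' ha (Submonoid.mem_sup_left haQ)
    exact Set.disjoint_left.1 hdisj' (hQ.2 ⟨hP, hIP⟩ hPQ hx)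
      (Submonoid.mem_sup_right (Submonoid.mem_powers x))
  obtain ⟨k, hk⟩ := Ideal.exists_pow_le_of_le_radical_of_fg hrad (IsNoetherian.noetherian Q)
  obtain ⟨v, hv, hvk⟩ := Ideal.exists_notMem_forall_mul_mem (IsNoetherian.noetherian (Q ^ k))
    (fun c hc => hk hc)
  exact ⟨k, v, hv, hvk⟩

theorem mem_associatedPrimes_iff {R M : Type*} [CommRing R] [IsNoetherianRing R] [AddCommGroup M]
    [Module R M] {η : Ideal R} :
    η ∈ associatedPrimes R M ↔ η.IsPrime ∧ ∃ m : M, ∀ r, r ∈ η ↔ r • m = 0 := by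
  rw [AssociatedPrimes.mem_iff, isAssociatedPrime_iff]
  refine and_congr_right fun _ => exists_congr fun m => ?_
  rw [Ideal.ext_iff]
  simp only [Submodule.mem_colon_singleton, Submodule.mem_bot]

theorem LocalizedModule.mk_eq_zero_iff {R M : Type*} [CommRing R] [AddCommGroup M] [Module R M]
    {W : Submonoid R} {m : M} {u : W} :
    (LocalizedModule.mk m u : LocalizedModule W M) = 0 ↔ ∃ v : W, v • m = 0 := by
  rw [← LocalizedModule.zero_mk 1, LocalizedModule.mk_eq]
  simp only [one_smul, smul_zero]

/-! ### Orbits under localization -/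

namespace CartierModule

section orbit

variable {p : ℕ} {R : Type u} [CommRing R] {C : CartierAlgebra.{u, w} p R}
  {M : Type v} [AddCommGroup M] [Module R M] (ρ : CartierModule C M)

/-- Because v κ(m') = κ(v^q m') = (κ v^{q-1})(v m'), scalars can be moved along an orbit by changing
the operators. -/
theorem PlusOrbit.smul [Fact p.Prime] {h : ℕ} {m m' : M} (H : ρ.PlusOrbit h m m') (v : R) :
    ρ.PlusOrbit h (v • m) (v • m') := by
  induction H with
  | zero => exact .zero _
  | succ he x _ ih =>
    rename_i m' e _
    have : v • ρ.act e x m' = ρ.act e (v ^ (p ^ e - 1) • x) (v • m') := by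
      rw [ρ.act_right, smul_smul, pow_sub_one_mul (pow_ne_zero e (Fact.out : p.Prime).ne_zero),
        ρ.isCartierLinear]
    rw [this]
    exact .succ he _ ih

/-- From c κ(m) = κ(c^q m): annihilators can only grow along an orbit. -/
theorem PlusOrbit.smul_eq_zero [Fact p.Prime] {h : ℕ} {m m' : M} (H : ρ.PlusOrbit h m m')
    {I : Ideal R} (hI : ∀ c ∈ I, c • m = 0) : ∀ c ∈ I, c • m' = 0 := by
  induction H with
  | zero => exact hI
  | succ he x _ ih =>
    rename_i m' e _
    intro c hc
    rw [← ρ.isCartierLinear, ih hI _ (Ideal.pow_mem_of_mem _ hc _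
      (Nat.pos_of_ne_zero (pow_ne_zero e (Fact.out : p.Prime).ne_zero))), map_zero]

/-- Every element of `M` killed by a power of `η` has all its orbits of length `h` in `N`, locally
at `η`. -/
def NilAt (η : Ideal R) (N : Submodule R M) (h : ℕ) : Prop :=
  ∀ m : M, (∃ k : ℕ, ∀ c ∈ η ^ k, c • m = 0) → ∀ m', ρ.PlusOrbit h m m' → ∃ w, w ∉ η ∧ w • m' ∈ N

/-- One further operator is harmless: w κ(m') = κ(w^q m'), and N is a Cartier submodule. -/
theorem NilAt.mono [Fact p.Prime] {ρ : CartierModule C M} {η : Ideal R} {N : Submodule R M}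
    (hN : ρ.IsCartierSubmodule N) {h h' : ℕ} (H : ρ.NilAt η N h) (hle : h ≤ h') :
    ρ.NilAt η N h' := by
  induction hle with
  | refl => exact H
  | step _ ih =>
    intro m hm m' hm'
    cases hm' with
    | succ he x hx =>
      rename_i m' e
      obtain ⟨w, hw, hwN⟩ := ih m hm m' hx
      refine ⟨w, hw, ?_⟩
      rw [← ρ.isCartierLinear]
      refine hN e x _ ?_
      rw [← pow_sub_one_mul (pow_ne_zero e (Fact.out : p.Prime).ne_zero), mul_smul]
      exact N.smul_mem _ hwN

end orbit

section localization

variable {p : ℕ} [Fact p.Prime] {R : Type u} [CommRing R] [CharP R p]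
  {C : CartierAlgebra.{u, w} p R} {M : Type v} [AddCommGroup M] [Module R M]
  (ρ : CartierModule C M) (W : Submonoid R)

theorem exists_eq_tmul_mk_one {e : ℕ} (y : C.deg e ⊗[R] Localization W) :
    ∃ (x : C.deg e) (w : W), y = x ⊗ₜ[R] Localization.mk 1 w := by
  induction y using TensorProduct.induction_on with
  | zero => exact ⟨0, 1, by rw [TensorProduct.zero_tmul]⟩
  | tmul x c =>
    induction c using Localization.induction_on with
    | H c =>
      obtain ⟨r, w⟩ := c
      refine ⟨r • x, w, ?_⟩
      rw [TensorProduct.smul_tmul, Localization.smul_mk, smul_eq_mul, mul_one]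
  | add a b ha hb =>
    obtain ⟨x, w, rfl⟩ := ha
    obtain ⟨x', w', rfl⟩ := hb
    refine ⟨(w' : R) • x + (w : R) • x', w * w', ?_⟩
    rw [TensorProduct.add_tmul, TensorProduct.smul_tmul, TensorProduct.smul_tmul,
      Localization.smul_mk, Localization.smul_mk]
    congr 2
    · rw [Localization.mk_eq_mk_iff, Localization.r_iff_exists]
      exact ⟨1, by simp [mul_comm]⟩
    · rw [Localization.mk_eq_mk_iff, Localization.r_iff_exists]
      exact ⟨1, by simp [mul_comm]⟩

theorem localization_act_mk {e : ℕ} (x : C.deg e) (w : W) (m : M) (u : W) :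
    (ρ.localization W).act e (x ⊗ₜ[R] Localization.mk 1 w : C.deg e ⊗[R] Localization W)
      (LocalizedModule.mk m u) =
      LocalizedModule.mk (ρ.act e (((w * u : W) : R) ^ (p ^ e - 1) • x) m) (w * u) := by
  change ρ.locAct W e (pow_ne_zero e (Fact.out : p.Prime).ne_zero) x (Localization.mk 1 w • LocalizedModule.mk m u) = _
  rw [LocalizedModule.mk_smul_mk, one_smul, locAct_mk, ρ.act_right]

/-- By common denominators an element of the localized algebra is a single κ ⊗ 1/w, and its action
on m/u is again an operator applied to m, over a denominator. -/
theorem exists_plusOrbit_of_localization {h : ℕ} {m : M} {u : W} {z : LocalizedModule W M}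
    (H : (ρ.localization W).PlusOrbit h (LocalizedModule.mk m u) z) :
    ∃ (m' : M) (u' : W), ρ.PlusOrbit h m m' ∧ z = LocalizedModule.mk m' u' := by
  generalize hy : LocalizedModule.mk m u = y at H
  induction H with
  | zero => exact ⟨m, u, .zero m, hy.symm⟩
  | succ he x _ ih =>
    obtain ⟨m', u', hm', rfl⟩ := ih hy
    obtain ⟨x, w, rfl⟩ := exists_eq_tmul_mk_one W x
    exact ⟨_, _, .succ he _ hm', ρ.localization_act_mk W x w m' u'⟩

theorem PlusOrbit.localization {ρ : CartierModule C M} {h : ℕ} {m m' : M}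
    (H : ρ.PlusOrbit h m m') :
    (ρ.localization W).PlusOrbit h (LocalizedModule.mk m 1) (LocalizedModule.mk m' 1) := by
  induction H with
  | zero => exact .zero _
  | succ he x _ ih =>
    rename_i m' e _
    have h1 := ρ.localization_act_mk W x 1 m' 1
    rw [one_mul, OneMemClass.coe_one, one_pow, one_smul] at h1
    rw [← h1]
    exact .succ he _ ih

end localization

/-! ### Test submodules described without localization -/

section test

variable {p : ℕ} [Fact p.Prime] {R : Type u} [CommRing R] [CharP R p] [IsNoetherianRing R]
  {C : CartierAlgebra.{u, w} p R} {M : Type v} [AddCommGroup M] [Module R M]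
  (ρ : CartierModule C M)

theorem mem_localH0_of_forall {η : Ideal R} [η.IsPrime] {k : ℕ} {y : LocalizedModule η.primeCompl M}
    (h : ∀ c ∈ η ^ k, c • y = 0) : y ∈ localH0 M η := by
  refine ⟨k, fun c hc => ?_⟩
  have hle : (η ^ k).map (algebraMap R (Localization η.primeCompl)) ≤
      LinearMap.ker (LinearMap.toSpanSingleton (Localization η.primeCompl) _ y) := by
    rw [Ideal.map_le_iff_le_comap]
    intro r hr
    rw [Ideal.mem_comap, LinearMap.mem_ker, LinearMap.toSpanSingleton_apply, algebraMap_smul]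
    exact h r hr
  rw [← Localization.AtPrime.map_eq_maximalIdeal, ← Ideal.map_pow] at hc
  exact hle hc

theorem forall_of_mem_localH0 {η : Ideal R} [η.IsPrime] {y : LocalizedModule η.primeCompl M}
    (h : y ∈ localH0 M η) : ∃ k : ℕ, ∀ c ∈ η ^ k, c • y = 0 := by
  obtain ⟨k, hk⟩ := h
  refine ⟨k, fun c hc => ?_⟩
  rw [← algebraMap_smul (Localization η.primeCompl)]
  refine hk _ ?_
  rw [← Localization.AtPrime.map_eq_maximalIdeal, ← Ideal.map_pow]
  exact Ideal.mem_map_of_mem _ hc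

theorem mk_mem_localized_iff {η : Ideal R} [η.IsPrime] {N : Submodule R M} {m : M}
    {u : η.primeCompl} : LocalizedModule.mk m u ∈ N.localized η.primeCompl ↔
      ∃ w, w ∉ η ∧ w • m ∈ N := by
  rw [Submodule.mem_localized']
  simp only [← IsLocalizedModule.mk_eq_mk']
  constructor
  · rintro ⟨n, hn, s, hs⟩
    obtain ⟨c, hc⟩ := LocalizedModule.mk_eq.1 hs
    refine ⟨((c * s : η.primeCompl) : R), (c * s).2, ?_⟩
    have : ((c * s : η.primeCompl) : R) • m = c • u • n := by
      rw [hc, Submonoid.smul_def, Submonoid.smul_def, smul_smul]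
      rfl
    rw [this]
    exact N.smul_mem _ (N.smul_mem _ hn)
  · rintro ⟨w, hw, hwm⟩
    refine ⟨w • m, hwm, ⟨w, hw⟩ * u, ?_⟩
    exact LocalizedModule.mk_cancel_common_left ⟨w, hw⟩ u m

theorem nilInto_iff {η : Ideal R} [η.IsPrime] {N : Submodule R M} :
    (ρ.localization η.primeCompl).NilInto (localH0 M η)
        ((N.localized η.primeCompl : Set (LocalizedModule η.primeCompl M)) ∩ localH0 M η) ↔
      ∃ h, ρ.NilAt η N h := by
  refine exists_congr fun h => ⟨fun H m hm m' hm' => ?_, fun H y hy z hz => ?_⟩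
  · obtain ⟨k, hk⟩ := hm
    have h1 : (LocalizedModule.mk m 1 : LocalizedModule η.primeCompl M) ∈ localH0 M η :=
      mem_localH0_of_forall fun c hc => by
        rw [LocalizedModule.smul'_mk, hk c hc, LocalizedModule.zero_mk]
    exact mk_mem_localized_iff.1 (H _ h1 _ (hm'.localization η.primeCompl)).1
  · induction y using LocalizedModule.induction_on with
    | h m u =>
      obtain ⟨k, hk⟩ := forall_of_mem_localH0 hy
      -- The power of η kills m only after localization; a single v outside η makes it kill v m in M
      -- itself, where `NilAt` applies.
      obtain ⟨v, hv, hvk⟩ := Ideal.exists_notMem_forall_mul_mem (η := η)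
        (K := LinearMap.ker (LinearMap.toSpanSingleton R M m)) (IsNoetherian.noetherian (η ^ k))
        (fun c hc => by
          have h1 := hk c hc
          rw [LocalizedModule.smul'_mk, LocalizedModule.mk_eq_zero_iff] at h1
          obtain ⟨v, hv⟩ := h1
          exact ⟨v, v.2, by
            rw [LinearMap.mem_ker, LinearMap.toSpanSingleton_apply, mul_smul]; exact hv⟩)
      have hvk' : ∀ c ∈ η ^ k, c • v • m = 0 := fun c hc => by
        have := hvk c hc
        rwa [LinearMap.mem_ker, LinearMap.toSpanSingleton_apply, mul_comm, mul_smul] at this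
      obtain ⟨m', u', hm', rfl⟩ := ρ.exists_plusOrbit_of_localization _ hz
      have hvm' := hm'.smul ρ v
      obtain ⟨w, hw, hwN⟩ := H (v • m) ⟨k, hvk'⟩ _ hvm'
      refine ⟨mk_mem_localized_iff.2 ⟨w * v, fun hmem =>
        (Ideal.IsPrime.mem_or_mem ‹_› hmem).elim hw hv, by rwa [mul_smul]⟩, ?_⟩
      refine mem_localH0_of_forall (k := k) fun c hc => ?_
      rw [LocalizedModule.smul'_mk, LocalizedModule.mk_eq_zero_iff]
      refine ⟨⟨v, hv⟩, ?_⟩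
      rw [Submonoid.smul_def, smul_comm]
      exact hvm'.smul_eq_zero ρ hvk' c hc

theorem isTestSubmodule_iff {N : Submodule R M} :
    ρ.IsTestSubmodule N ↔ ρ.IsCartierSubmodule N ∧
      ∀ η ∈ associatedPrimes R M, ∃ h, ρ.NilAt η N h := by
  refine and_congr_right fun _ => ⟨fun H η hη => ?_, fun H η _ hη => ρ.nilInto_iff.2 (H η hη)⟩
  have := hη.isPrime
  exact ρ.nilInto_iff.1 (H η hη)

theorem isFRegular_iff : ρ.IsFRegular ↔ ∀ N, ρ.IsTestSubmodule N → N = ⊤ := by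
  rw [IsFRegular, testModule, sInf_eq_top]
  rfl

end test
end CartierModule
end

noncomputable section

open IsLocalRing

/-! ### `F`-regularity and transposition -/

variable {p : ℕ} [Fact p.Prime] {R : Type u} [CommRing R] [CharP R p]
  {S : Type v} [CommRing S] [Algebra R S]
  {C : CartierAlgebra.{u, w} p R} {ρ : CartierModule C R} {σ : S →ₗ[S] UpperShriek R S R}

theorem apply_one_algebraMap_mul (r : R) (s : S) : σ 1 (algebraMap R S r * s) = r * σ 1 s := by
  rw [← Algebra.smul_def, map_smul, smul_eq_mul]

variable (σ) in
/-- The largest ideal of `S` that `T = σ 1` maps into `N`. -/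
def traceColon (N : Ideal R) : Ideal S where
  carrier := {s | ∀ t, σ 1 (s * t) ∈ N}
  zero_mem' t := by rw [zero_mul, map_zero]; exact N.zero_mem
  add_mem' ha hb t := by rw [add_mul, map_add]; exact N.add_mem (ha t) (hb t)
  smul_mem' c s hs t := by
    rw [smul_eq_mul, mul_comm c, mul_assoc]
    exact hs _

theorem isCartierSubmodule_traceColon (hσ : Function.Injective σ) (hT : IsTransposable σ ρ)
    {N : Ideal R} (hN : ρ.IsCartierSubmodule N) :
    (transposeModule hσ hT).IsCartierSubmodule (traceColon σ N) := by
  intro e y m hm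
  refine transposeModule_act_mem hσ hT (H := (traceColon σ N).toAddSubgroup) (fun x s t => ?_) y
  rw [apply_one_transpose_mul]
  refine hN e x _ ?_
  rw [mul_comm s, mul_assoc]
  exact hm _

/-- T turns orbits over S into orbits over R by the transposition identity. The additive closure is
needed since elements of f^*𝒞 are sums of pure tensors. -/
theorem apply_one_mul_mem_closure_of_plusOrbit (hσ : Function.Injective σ)
    (hT : IsTransposable σ ρ) {h : ℕ} {s z : S} (H : (transposeModule hσ hT).PlusOrbit h s z) :
    ∀ t, σ 1 (z * t) ∈ AddSubgroup.closure {r | ∃ a, ρ.PlusOrbit h (σ 1 (s * a)) r} := by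
  induction H with
  | zero => exact fun t => AddSubgroup.subset_closure ⟨t, .zero _⟩
  | succ he y _ ih =>
    rename_i h s z e _
    intro t
    let μ : S →+ R := (AddMonoidHomClass.toAddMonoidHom (σ 1)).comp (AddMonoidHom.mulRight t)
    refine transposeModule_act_mem hσ hT (H := (AddSubgroup.closure
      {r | ∃ a, ρ.PlusOrbit (h + 1) (σ 1 (s * a)) r}).comap μ) (fun x a => ?_) y
    change σ 1 (transpose hT x (a * z) * t) ∈ AddSubgroup.closure
      {r | ∃ a, ρ.PlusOrbit (h + 1) (σ 1 (s * a)) r}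
    rw [apply_one_transpose_mul, mul_comm a, mul_assoc]
    have hr := ih (a * t ^ p ^ e)
    generalize σ 1 (z * (a * t ^ p ^ e)) = r at hr
    induction hr using AddSubgroup.closure_induction with
    | mem r hr =>
      obtain ⟨b, hb⟩ := hr
      exact AddSubgroup.subset_closure ⟨b, .succ he x hb⟩
    | zero => rw [map_zero]; exact AddSubgroup.zero_mem _
    | add r r' _ _ hr hr' => rw [map_add]; exact AddSubgroup.add_mem _ hr hr'
    | neg r _ hr => rw [map_neg]; exact AddSubgroup.neg_mem _ hr

section

variable [IsNoetherianRing R] [Module.Finite R S]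

/-- Let η = Ann(s) and let (g_i) generate S over R. By injectivity of σ, an r ∈ R killing all T(s
g_i) kills s. So η ∩ R contains the finite intersection of the ideals Ann T(s g_i), and being prime
it contains, hence equals, one of them. -/
theorem comap_mem_associatedPrimes (hσ : Function.Injective σ) {η : Ideal S}
    (hη : η ∈ associatedPrimes S S) : η.comap (algebraMap R S) ∈ associatedPrimes R R := by
  have hN : IsNoetherianRing S := IsNoetherianRing.of_finite R S
  obtain ⟨hprime, s, hs⟩ := mem_associatedPrimes_iff.1 hη
  obtain ⟨n, g, hg⟩ := Module.Finite.exists_fin (R := R) (M := S)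
  have hP : (η.comap (algebraMap R S)).IsPrime := Ideal.comap_isPrime _ _
  let A : Fin n → Ideal R := fun i => LinearMap.ker (LinearMap.toSpanSingleton R R (σ 1 (s * g i)))
  have hA : ∀ i r, r ∈ A i ↔ r * σ 1 (s * g i) = 0 := fun i r => by
    rw [LinearMap.mem_ker, LinearMap.toSpanSingleton_apply, smul_eq_mul]
  have hle : Finset.univ.inf A ≤ η.comap (algebraMap R S) := by
    intro r hr
    rw [Ideal.mem_comap, hs, smul_eq_mul]
    apply hσ
    rw [map_zero]
    ext t
    rw [apply_eq_apply_one_mul, mul_assoc, apply_one_algebraMap_mul]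
    change _ = 0
    have ht : t ∈ Submodule.span R (Set.range g) := hg ▸ Submodule.mem_top
    induction ht using Submodule.span_induction with
    | mem t ht =>
      obtain ⟨i, rfl⟩ := ht
      exact (hA i r).1 (Finset.inf_le (f := A) (Finset.mem_univ i) hr)
    | zero => rw [mul_zero, map_zero, mul_zero]
    | add a b _ _ ha hb => rw [mul_add, map_add, mul_add, ha, hb, add_zero]
    | smul c a _ ha => rw [mul_smul_comm, map_smul, smul_eq_mul, mul_left_comm, ha, mul_zero]
  obtain ⟨i, -, hi⟩ := (Ideal.IsPrime.inf_le' hP).1 hle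
  refine mem_associatedPrimes_iff.2 ⟨hP, σ 1 (s * g i), fun r => ⟨fun hr => ?_, fun hr => ?_⟩⟩
  · rw [Ideal.mem_comap, hs, smul_eq_mul] at hr
    rw [smul_eq_mul, ← apply_one_algebraMap_mul, ← mul_assoc, hr, zero_mul, map_zero]
  · exact hi ((hA i r).2 hr)

theorem nilAt_traceColon (hσ : Function.Injective σ) (hT : IsTransposable σ ρ) {N : Ideal R}
    {η : Ideal S} [η.IsPrime] {h : ℕ} (H : ρ.NilAt (η.comap (algebraMap R S)) N h) :
    (transposeModule hσ hT).NilAt η (traceColon σ N) h := by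
  intro s ⟨k, hk⟩ z hz
  have hP : (η.comap (algebraMap R S)).IsPrime := Ideal.comap_isPrime _ _
  have key : ∀ t, ∃ w, w ∉ η.comap (algebraMap R S) ∧ w * σ 1 (z * t) ∈ N := by
    intro t
    have ht := apply_one_mul_mem_closure_of_plusOrbit hσ hT hz t
    generalize σ 1 (z * t) = r at ht
    induction ht using AddSubgroup.closure_induction with
    | mem r hr =>
      obtain ⟨a, ha⟩ := hr
      refine H _ ⟨k, fun c hc => ?_⟩ _ ha
      have hc' : algebraMap R S c ∈ η ^ k :=
        Ideal.le_comap_pow _ _ hc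
      have := hk _ hc'
      rw [smul_eq_mul] at this
      rw [smul_eq_mul, ← apply_one_algebraMap_mul, ← mul_assoc, this, zero_mul, map_zero]
    | zero =>
      exact ⟨1, (Ideal.ne_top_iff_one _).1 hP.ne_top, by rw [mul_zero]; exact N.zero_mem⟩
    | add a b _ _ ha hb =>
      obtain ⟨v, hv, hva⟩ := ha
      obtain ⟨w, hw, hwb⟩ := hb
      refine ⟨v * w, fun hmem => (hP.mem_or_mem hmem).elim hv hw, ?_⟩
      rw [mul_add]
      refine N.add_mem ?_ ?_
      · rw [mul_right_comm]
        exact N.mul_mem_right _ hva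
      · rw [mul_assoc]
        exact N.mul_mem_left _ hwb
    | neg a _ ha =>
      obtain ⟨v, hv, hva⟩ := ha
      exact ⟨v, hv, by rw [mul_neg]; exact N.neg_mem hva⟩
  -- So far the multiplier depends on t; the ideal T(zS) is finitely generated, so one w serves all
  -- t.
  let I : Ideal R := LinearMap.range ((show S →ₗ[R] R from σ 1) ∘ₗ LinearMap.mulLeft R z)
  obtain ⟨w, hw, hwI⟩ := Ideal.exists_notMem_forall_mul_mem (I := I) (K := N)
    (IsNoetherian.noetherian I) (by
      rintro c ⟨t, rfl⟩
      exact key t)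
  refine ⟨algebraMap R S w, hw, fun t => ?_⟩
  rw [smul_eq_mul, mul_assoc, apply_one_algebraMap_mul]
  exact hwI _ ⟨t, rfl⟩

theorem isFRegular_of_transposeModule [CharP S p] (hσ : Function.Injective σ)
    (hT : IsTransposable σ ρ) (hsurj : Function.Surjective (σ 1))
    (h : (transposeModule hσ hT).IsFRegular) : ρ.IsFRegular := by
  have hS : IsNoetherianRing S := IsNoetherianRing.of_finite R S
  rw [CartierModule.isFRegular_iff] at h ⊢
  intro N hN
  rw [CartierModule.isTestSubmodule_iff] at hN
  have htop := h (traceColon σ N) ((CartierModule.isTestSubmodule_iff _).2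
    ⟨isCartierSubmodule_traceColon hσ hT hN.1, fun η hη => by
      have := hη.isPrime
      obtain ⟨h, hh⟩ := hN.2 _ (comap_mem_associatedPrimes hσ hη)
      exact ⟨h, nilAt_traceColon hσ hT hh⟩⟩)
  refine eq_top_iff.2 fun r _ => ?_
  obtain ⟨t, rfl⟩ := hsurj r
  have h1 : (1 : S) ∈ traceColon σ N := htop ▸ Submodule.mem_top
  rw [← one_mul t]
  exact h1 t

/-- Orbits lift step by step through κ ⊗ 1, since T ∘ κ^⊤ = κ ∘ T. -/
theorem exists_plusOrbit_transposeModule (hσ : Function.Injective σ) (hT : IsTransposable σ ρ)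
    {h : ℕ} {r r' : R} (H : ρ.PlusOrbit h r r') {s : S} (hs : σ 1 s = r) :
    ∃ z, (transposeModule hσ hT).PlusOrbit h s z ∧ σ 1 z = r' := by
  induction H with
  | zero => exact ⟨s, .zero _, hs⟩
  | succ he x _ ih =>
    obtain ⟨z, hz, rfl⟩ := ih hs
    refine ⟨_, .succ he (x ⊗ₜ[R] 1 : C.deg _ ⊗[R] S) hz, ?_⟩
    rw [transposeModule_act_tmul, one_mul, apply_one_transpose]

variable (σ) in
/-- The image of the ideal `N` under `T = σ 1`. -/
def traceMap (N : Ideal S) : Ideal R :=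
  (N.restrictScalars R).map (show S →ₗ[R] R from σ 1)

theorem mem_traceMap {N : Ideal S} {r : R} : r ∈ traceMap σ N ↔ ∃ s ∈ N, σ 1 s = r := Iff.rfl

theorem isCartierSubmodule_traceMap (hσ : Function.Injective σ) (hT : IsTransposable σ ρ)
    {N : Ideal S} (hN : (transposeModule hσ hT).IsCartierSubmodule N) :
    ρ.IsCartierSubmodule (traceMap σ N) := by
  rintro e x _ ⟨s, hs, rfl⟩
  have h1 := hN e (x ⊗ₜ[R] 1 : C.deg _ ⊗[R] S) s hs
  rw [transposeModule_act_tmul, one_mul] at h1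
  exact ⟨_, h1, apply_one_transpose hT x s⟩

/-- If the elements of `N` near all associated primes absorb the orbits of length `h`, then the
orbits of an element killed by a power of a prime `η` of `R` are absorbed near `η`. -/
theorem exists_algebraMap_mul_mem_of_plusOrbit [CharP S p] (hσ : Function.Injective σ)
    (hT : IsTransposable σ ρ) {N : Ideal S} {h : ℕ}
    (H : ∀ Q ∈ associatedPrimes S S, (transposeModule hσ hT).NilAt Q N h) {η : Ideal R}
    [η.IsPrime] {s z : S} {k : ℕ} (hk : ∀ c ∈ η ^ k, algebraMap R S c * s = 0)
    (hz : (transposeModule hσ hT).PlusOrbit h s z) :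
    ∃ w, w ∉ η ∧ algebraMap R S w * z ∈ N := by
  have hS : IsNoetherianRing S := IsNoetherianRing.of_finite R S
  let J : Ideal S := Submodule.comap (LinearMap.toSpanSingleton S S z) N
  have hJ : ∀ v, v ∈ J ↔ v * z ∈ N := fun v => Iff.rfl
  -- Otherwise the ideal J = {v : v z ∈ N} contracts into η, and it is contained in a prime Q lying
  -- over η.
  by_contra! hcon
  obtain ⟨Q, hJQ, hQ, hQη⟩ := Ideal.exists_ideal_over_prime_of_isIntegral η J fun w hw => by
    by_contra hwη
    exact hcon w hwη hw
  let A : Ideal S := (⊥ : Submodule S S).colon {s}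
  have hA : ∀ v, v ∈ A ↔ v • s = 0 := fun v => by
    rw [Submodule.mem_colon_singleton, Submodule.mem_bot]
  have hAJ : A ≤ J := fun v hv => by
    have := hz.smul_eq_zero _ (fun c hc => (hA c).1 hc) v hv
    rw [hJ, ← smul_eq_mul, this]
    exact N.zero_mem
  have hηA : ∀ P : Ideal S, P.IsPrime → A ≤ P → η ≤ P.comap (algebraMap R S) := by
    intro P hP hAP c hc
    refine hP.mem_of_pow_mem k (hAP ((hA _).2 ?_))
    rw [← map_pow, smul_eq_mul]
    exact hk _ (Ideal.pow_mem_pow hc k)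
  -- Every prime over A = Ann(s) contracts to a prime containing η, so by incomparability none lies
  -- strictly below Q. Thus Q is associated and the hypothesis on N applies at Q.
  have hmin : Q ∈ A.minimalPrimes := by
    refine ⟨⟨hQ, hAJ.trans hJQ⟩, fun P hP hPQ => ?_⟩
    have hPp : P.IsPrime := hP.1
    by_contra hQP
    have hlt := Ideal.IsIntegral.comap_lt_comap (R := R) (lt_of_le_not_ge hPQ hQP)
    rw [hQη] at hlt
    exact not_le_of_gt hlt (hηA P hP.1 hP.2)
  have hass : Q ∈ associatedPrimes S S := by
    obtain ⟨x, hx⟩ := Submodule.exists_eq_colon_of_mem_minimalPrimes hmin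
    refine mem_associatedPrimes_iff.2 ⟨hQ, x, fun r => ?_⟩
    rw [hx, Submodule.mem_colon_singleton, Submodule.mem_bot]
  obtain ⟨l, v, hv, hvl⟩ := Ideal.exists_notMem_pow_mul_mem_of_mem_minimalPrimes hmin
  -- The multiple v s is killed by Q^l, and v z lies in its orbit; so w v ∈ J ⊂ Q with v, w ∉ Q, a
  -- contradiction.
  obtain ⟨w, hw, hwN⟩ := H Q hass (v • s) ⟨l, fun c hc => by
    rw [smul_smul, mul_comm, (hA _).1 (hvl c hc)]⟩ _ (hz.smul _ v)
  have : w * v ∈ J := by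
    rw [hJ, mul_assoc]
    exact hwN
  exact (hQ.mem_or_mem (hJQ this)).elim hw hv

theorem isFRegular_transposeModule [CharP S p] [IsLocalRing R] [IsLocalRing S]
    (hσ : Function.Injective σ) (hT : IsTransposable σ ρ) (hsurj : Function.Surjective (σ 1))
    (hmax : ∀ s ∈ maximalIdeal S, σ 1 s ∈ maximalIdeal R) (h : ρ.IsFRegular) :
    (transposeModule hσ hT).IsFRegular := by
  have hS : IsNoetherianRing S := IsNoetherianRing.of_finite R S
  rw [CartierModule.isFRegular_iff] at h ⊢
  intro N hN
  rw [CartierModule.isTestSubmodule_iff] at hN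
  obtain ⟨hN, hnil⟩ := hN
  -- There are finitely many associated primes, so one orbit length serves all of them.
  obtain ⟨l, hl⟩ : ∃ l, ∀ Q ∈ associatedPrimes S S, (transposeModule hσ hT).NilAt Q N l := by
    choose! f hf using hnil
    have hfin := associatedPrimes.finite S S
    exact ⟨hfin.toFinset.sup f, fun Q hQ =>
      (hf Q hQ).mono hN (Finset.le_sup (f := f) (hfin.mem_toFinset.2 hQ))⟩
  obtain ⟨s₀, hs₀⟩ := hsurj 1
  have htop := h (traceMap σ N) ((CartierModule.isTestSubmodule_iff _).2
    ⟨isCartierSubmodule_traceMap hσ hT hN, fun η hη => ⟨l, fun r ⟨k, hk⟩ r' hr' => by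
      have := hη.isPrime
      -- The lift r s₀ of r along T is killed by whatever kills r.
      have hs : σ 1 (algebraMap R S r * s₀) = r := by
        rw [apply_one_algebraMap_mul, hs₀, mul_one]
      obtain ⟨z, hz, rfl⟩ := exists_plusOrbit_transposeModule hσ hT hr' hs
      obtain ⟨w, hw, hwz⟩ := exists_algebraMap_mul_mem_of_plusOrbit hσ hT hl (η := η) (k := k)
        (fun c hc => by
          rw [← mul_assoc, ← map_mul, ← smul_eq_mul c, hk c hc, map_zero, zero_mul]) hz
      exact ⟨w, hw, _, hwz, apply_one_algebraMap_mul w z⟩⟩⟩)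
  -- A proper N lies in 𝔫, and then T(N) ⊂ 𝔪 cannot contain 1.
  by_contra hne
  have h1 : (1 : R) ∈ traceMap σ N := htop ▸ Submodule.mem_top
  obtain ⟨s, hs, hs1⟩ := mem_traceMap.1 h1
  have := hmax s (le_maximalIdeal hne hs)
  rw [hs1] at this
  exact (Ideal.ne_top_iff_one _).1 (maximalIdeal.isMaximal R).ne_top this

end

end

theorem mainTheorem2 {p : ℕ} [Fact p.Prime]
    {R : Type u} [CommRing R] [IsLocalRing R] [IsNoetherianRing R] [CharP R p]
    (hF : (frobenius R p).Finite)
    {S : Type v} [CommRing S] [IsLocalRing S] [CharP S p] [Algebra R S]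
    [IsLocalHom (algebraMap R S)] [Module.Finite R S] (hRS : Function.Injective (algebraMap R S))
    (hflat : Module.Flat (FractionRing R) (FractionRing R ⊗[R] S))
    (C : CartierAlgebra.{u, w} p R) (ρ : CartierModule C R)
    (σ : S →ₗ[S] UpperShriek R S R) (hσ : Function.Injective σ)
    (hgen : Function.Bijective (LinearMap.lTensor (FractionRing R) (σ.restrictScalars R)))
    (hsurj : Function.Surjective (σ 1))
    (hmax : ∀ s ∈ IsLocalRing.maximalIdeal S, σ 1 s ∈ IsLocalRing.maximalIdeal R)
    (hT : IsTransposable σ ρ) :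
    (∃ sR sS : ℝ, ρ.HasFSignature sR ∧ (transposeModule hσ hT).HasFSignature sS ∧
      (Module.finrank (IsLocalRing.ResidueField R) (IsLocalRing.ResidueField S) : ℝ) * sS =
        (Module.finrank (FractionRing R) (FractionRing R ⊗[R] S) : ℝ) * sR) ∧
    (ρ.IsFRegular ↔ (transposeModule hσ hT).IsFRegular) :=
  ⟨exists_hasFSignature_transposeModule hF hRS hσ hT hsurj hmax,
    isFRegular_transposeModule hσ hT hsurj hmax, isFRegular_of_transposeModule hσ hT hsurj⟩
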